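/- Let $\lambda=2\cos(\pi/5)$, let $S=\begin{pmatrix}0&1\\-1&0\end{pmatrix}$, $T=\begin{pmatrix}1&\lambda\\0&1\end{pmatrix}$, let $H_5=\langle S,T\rangle\subset SL(2,\mathbb Z[\lambda])$, $Z=\{\pm I\}$, and let $G_5=H_5/Z$ be the inhomogeneous Hecke group. For $\pi\in\mathbb Z[\lambda]$ let $H(\pi)=\{A\in H_5: A\equiv I \pmod{\pi}\}$ and $G(\pi)=H(\pi)Z/Z$. A subgroup $K$ of $G_5$ is called congruence if $G(\pi)\subseteq K$ for some nonzero $\pi\in\mathbb Z[\lambda]$. For a subgroup $K$ of finite index in $G_5$, the width of a cusp $x$ (a point of the $G_5$-orbit of $\infty$) is the smallest positive integer $m$ such that $\pm T^m$ is conjugate in $G_5$ to an element of $K$ fixing $x$; the geometric level of $K$ is the least common multiple of its cusp widths; and $v_2(K)$ is the number of $K$-orbits of points of the upper half plane fixed by an element of order $2$ of $K$. Let $K$ be the subgroup of $G_5$ whose special polygon is the ideal pentagon with vertices $-\infty=\infty,\ 0,\ 1/\lambda,\ \lambda/\lambda,\ \lambda$, in which the sides $(\infty,0)$ and $(\lambda,\infty)$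 are paired with each other and each of the sides $(0,1/\lambda)$, $(1/\lambda,\lambda/\lambda)$, $(\lambda/\lambda,\lambda)$ is paired with itself by an elliptic element of order $2$. That is, with $U=ST^{-1}$, let $K$ be generated by the classes of $T$, $USU^{-1}$, $U^2SU^{-2}$ and $U^3SU^{-3}$. Then $K$ has index $5$ in $G_5$, $v_2(K)=3$, the geometric level of $K$ is $4$, $K$ has exactly $5$ conjugates in $G_5$, and $K$ is not congruence. Consequently it is not true that all subgroups of index at most $6$ of $G_5$ are congruence, whereas every subgroup of index at most $6$ of $PSL(2,\mathbb Z)$ is congruence, that is, contains the image of $\Gamma(N)$ for some integer $N\ge 1$. -/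

import Mathlib

noncomputable section

namespace HeckeFive

open scoped MatrixGroups UpperHalfPlane OnePoint

/-- The number `λ = 2 cos (π / 5)`. -/
def lamReal : ℝ := 2 * Real.cos (Real.pi / 5)

/-- The ring `ℤ[λ]`, as a subring of `ℝ`. -/
abbrev ZLam : Type := Algebra.adjoin ℤ ({lamReal} : Set ℝ)

/-- The generator `λ` of `ℤ[λ]`. -/
def lam : ZLam := ⟨lamReal, Algebra.subset_adjoin (Set.mem_singleton _)⟩

/-- `T = (1 λ; 0 1)`, as a matrix over `ℤ[λ]`. -/
def matT : SL(2, ZLam) := ⟨!![1, lam; 0, 1], by simp [Matrix.det_fin_two_of]⟩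

/-- `S = (0 1; -1 0)`, as a matrix over `ℤ[λ]`. -/
def matS : SL(2, ZLam) := ⟨!![0, 1; -1, 0], by simp [Matrix.det_fin_two_of]⟩

/-- The homogeneous Hecke group `H₅ = ⟨S, T⟩`. -/
def H5 : Subgroup SL(2, ZLam) := Subgroup.closure {matS, matT}

/-- `S` as an element of `H₅`. -/
def hS : H5 := ⟨matS, Subgroup.subset_closure (by simp)⟩

/-- `T` as an element of `H₅`. -/
def hT : H5 := ⟨matT, Subgroup.subset_closure (by simp)⟩

/-- `Z = ⟨±I⟩`, as a subgroup of `H₅`. -/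
def Z5 : Subgroup H5 := (Subgroup.zpowers (-1 : SL(2, ZLam))).subgroupOf H5

theorem mat_ext {a b c d a' b' c' d' : ZLam} (h1 : a = a') (h2 : b = b') (h3 : c = c')
    (h4 : d = d') : !![a, b; c, d] = !![a', b'; c', d'] := by
  rw [h1, h2, h3, h4]

/-- `-I` lies in `H₅`. -/
theorem hS_sq : ((hS ^ 2 : H5) : SL(2, ZLam)) = -1 := by
  apply Subtype.ext
  rw [pow_two, Subgroup.coe_mul, Matrix.SpecialLinearGroup.coe_mul,
    Matrix.SpecialLinearGroup.coe_neg, Matrix.SpecialLinearGroup.coe_one]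
  change !![(0 : ZLam), 1; -1, 0] * !![0, 1; -1, 0] = _
  rw [Matrix.mul_fin_two]
  ext i j
  fin_cases i <;> fin_cases j <;> simp

instance Z5_normal : Z5.Normal := by
  refine ⟨fun n hn g => ?_⟩
  rw [Z5, Subgroup.mem_subgroupOf, Subgroup.mem_zpowers_iff] at hn ⊢
  obtain ⟨k, hk⟩ := hn
  refine ⟨k, ?_⟩
  have hc : Commute (g : SL(2, ZLam)) ((-1 : SL(2, ZLam)) ^ k) :=
    (Commute.neg_one_right (g : SL(2, ZLam))).zpow_right k
  rw [Subgroup.coe_mul, Subgroup.coe_mul, Subgroup.coe_inv, ← hk, hc.eq, mul_inv_cancel_right]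

/-- The inhomogeneous Hecke group `G₅ = H₅ / Z`. -/
abbrev G5 : Type := H5 ⧸ Z5

/-- The projection `H₅ → G₅`. -/
def proj : H5 →* G5 := QuotientGroup.mk' Z5

/-- `H(π) = {A ∈ H₅ : A ≡ I (mod π)}`, for `π ∈ ℤ[λ]`. -/
def principalH (p : ZLam) : Subgroup H5 :=
  ((Matrix.SpecialLinearGroup.map (n := Fin 2)
    (Ideal.Quotient.mk (Ideal.span ({p} : Set ZLam)))).comp H5.subtype).ker

/-- `G(π) = H(π) Z / Z`. -/
def principalG (p : ZLam) : Subgroup G5 := (principalH p).map proj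

/-- A subgroup of `G₅` is congruence if it contains `G(π)` for some nonzero `π ∈ ℤ[λ]`. -/
def IsCongruence (K : Subgroup G5) : Prop := ∃ p : ZLam, p ≠ 0 ∧ principalG p ≤ K

/-- The Möbius action of an element of `H₅` on `ℝ ∪ {∞}`. -/
def boundaryAct (h : H5) (x : OnePoint ℝ) : OnePoint ℝ :=
  Matrix.SpecialLinearGroup.mapGL ℝ (h : SL(2, ZLam)) • x

/-- The cusps of `G₅` (and of each of its subgroups of finite index): the orbit of `∞`. -/
def IsHeckeCusp (x : OnePoint ℝ) : Prop := ∃ h : H5, boundaryAct h ∞ = x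

/-- The width of the cusp `x` of `K`: the least positive integer `m` such that the class of `T ^ m`
is conjugate in `G₅` to an element of `K` fixing `x` (and `0` if there is no such `m`). -/
def cuspWidth (K : Subgroup G5) (x : OnePoint ℝ) : ℕ :=
  sInf {m : ℕ | 0 < m ∧
    ∃ h : H5, proj h ∈ K ∧ boundaryAct h x = x ∧ IsConj (proj (hT ^ m)) (proj h)}

/-- The geometric level of `K`: the least common multiple of its cusp widths, that is, the least
positive integer divisible by all of them (and `0` if there is no such integer). -/
def geometricLevel (K : Subgroup G5) : ℕ :=
  sInf {N : ℕ | 0 < N ∧ ∀ x : OnePoint ℝ, IsHeckeCusp x → cuspWidth K x ∣ N}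

/-- The preimage of `K` in `H₅`. It acts on the upper half plane through Möbius transformations,
with the same orbits as `K`. -/
abbrev preimageH (K : Subgroup G5) : Subgroup H5 := K.comap proj

/-- The elliptic points of order `2` of `K`: the points of the upper half plane that are fixed by
an element of order `2` of `K`. -/
def ellipticPointsTwo (K : Subgroup G5) : Set ℍ :=
  {z | ∃ h : preimageH K, orderOf (proj h) = 2 ∧ h • z = z}

/-- `v₂(K)`: the number of `K`-orbits of elliptic points of order `2` of `K`. -/
def v2 (K : Subgroup G5) : ℕ :=
  ((fun z : ℍ => (Quotient.mk (MulAction.orbitRel (preimageH K) ℍ) z)) ''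
    ellipticPointsTwo K).ncard

/-- `U = S T⁻¹`; its class in `G₅` has order `5` and permutes the ideal points
`∞ → 0 → 1/λ → λ/λ → λ → ∞` cyclically. -/
def hU : H5 := hS * hT⁻¹

/-- The rotation of order `2` that exchanges the end points of the even line
`U ^ i (∞, 0)`. -/
def sideInvolution (i : ℕ) : H5 := hU ^ i * hS * (hU ^ i)⁻¹

/-- The subgroup of `G₅` with special polygon the ideal pentagon with vertices
`-∞ = ∞, 0, 1/λ, λ/λ, λ`, whose sides `(∞, 0)` and `(λ, ∞)` are paired with each other (by `T`)
and whose sides `(0, 1/λ)`, `(1/λ, λ/λ)`, `(λ/λ, λ)` are each paired with themselves by an elliptic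
element of order `2`: the subgroup generated by these four side pairings. -/
def pentagonSubgroup : Subgroup G5 :=
  Subgroup.closure {proj hT, proj (sideInvolution 1), proj (sideInvolution 2),
    proj (sideInvolution 3)}

/-- A subgroup of `PSL(2, ℤ)` is congruence if it contains the image of `Γ(N)` for some
`N ≥ 1`. -/
def IsCongruencePSL (K : Subgroup (Matrix.ProjectiveSpecialLinearGroup (Fin 2) ℤ)) : Prop :=
  ∃ N : ℕ, N ≠ 0 ∧
    (CongruenceSubgroup.Gamma N).map
      (QuotientGroup.mk' (Subgroup.center SL(2, ℤ))) ≤ K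

theorem lam_sq : lam * lam = lam + 1 := by
  have h5 : Real.sqrt 5 * Real.sqrt 5 = 5 := Real.mul_self_sqrt (by norm_num)
  apply Subtype.ext
  change lamReal * lamReal = lamReal + 1
  rw [lamReal, Real.cos_pi_div_five]
  linear_combination h5 / 4

theorem hU_matrix : ((hU : SL(2, ZLam)) : Matrix (Fin 2) (Fin 2) ZLam) = !![0, 1; -1, lam] := by
  rw [hU, Subgroup.coe_mul, Matrix.SpecialLinearGroup.coe_mul, Subgroup.coe_inv,
    Matrix.SpecialLinearGroup.coe_inv]
  change !![(0 : ZLam), 1; -1, 0] * Matrix.adjugate !![1, lam; 0, 1] = _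
  rw [Matrix.adjugate_fin_two_of, Matrix.mul_fin_two]
  apply mat_ext <;> ring

theorem conj_hU (A : H5) (a b c d : ZLam)
    (hA : ((A : SL(2, ZLam)) : Matrix (Fin 2) (Fin 2) ZLam) = !![a, b; c, d]) :
    (((hU * A * hU⁻¹ : H5) : SL(2, ZLam)) : Matrix (Fin 2) (Fin 2) ZLam) =
      !![c * lam + d, -c; (-a + lam * c) * lam + (-b + lam * d), a - lam * c] := by
  rw [Subgroup.coe_mul, Subgroup.coe_mul, Matrix.SpecialLinearGroup.coe_mul,
    Matrix.SpecialLinearGroup.coe_mul, Subgroup.coe_inv, Matrix.SpecialLinearGroup.coe_inv,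
    hU_matrix, hA, Matrix.adjugate_fin_two_of, Matrix.mul_fin_two, Matrix.mul_fin_two]
  apply mat_ext <;> ring

theorem sideInvolution_succ (i : ℕ) :
    sideInvolution (i + 1) = hU * sideInvolution i * hU⁻¹ := by
  simp only [sideInvolution, pow_succ', mul_inv_rev, mul_assoc]

/-- The rotation exchanging the end points of the even line `(a/b, c/d)` is
`± (ab + cd, -(a² + c²); b² + d², -(ab + cd))`; here are the ones for `(0/1, 1/λ)`, `(1/λ, λ/λ)`
and `(λ/λ, λ/1)`. -/
theorem sideInvolution_matrix :
    ((sideInvolution 1 : SL(2, ZLam)) : Matrix (Fin 2) (Fin 2) ZLam) =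
        !![-lam, 1; -(1 + lam ^ 2), lam] ∧
    ((sideInvolution 2 : SL(2, ZLam)) : Matrix (Fin 2) (Fin 2) ZLam) =
        !![-(lam + lam ^ 2), 1 + lam ^ 2; -(2 * lam ^ 2), lam + lam ^ 2] ∧
    ((sideInvolution 3 : SL(2, ZLam)) : Matrix (Fin 2) (Fin 2) ZLam) =
        !![-(lam + lam ^ 2), 2 * lam ^ 2; -(1 + lam ^ 2), lam + lam ^ 2] := by
  have h := lam_sq
  have h0 : ((sideInvolution 0 : SL(2, ZLam)) : Matrix (Fin 2) (Fin 2) ZLam) =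
      !![0, 1; -1, 0] := by
    simp [sideInvolution, hS, matS]
  have h1 : ((sideInvolution 1 : SL(2, ZLam)) : Matrix (Fin 2) (Fin 2) ZLam) =
        !![-lam, 1; -(1 + lam ^ 2), lam] := by
    rw [sideInvolution_succ, conj_hU _ _ _ _ _ h0]
    apply mat_ext <;> ring
  have h2 : ((sideInvolution 2 : SL(2, ZLam)) : Matrix (Fin 2) (Fin 2) ZLam) =
        !![-(lam + lam ^ 2), 1 + lam ^ 2; -(2 * lam ^ 2), lam + lam ^ 2] := by
    rw [sideInvolution_succ, conj_hU _ _ _ _ _ h1]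
    clear h0 h1
    generalize lam = l at h
    apply mat_ext <;> grind
  refine ⟨h1, h2, ?_⟩
  rw [sideInvolution_succ, conj_hU _ _ _ _ _ h2]
  clear h0 h1 h2
  generalize lam = l at h
  apply mat_ext <;> grind

end HeckeFive

end

/-!
The group `G₅` is the free product of the cyclic groups generated by `S` and `U`, of orders `2`
and `5` (`exists_hom_G5`). This rests on one observation: up to sign, the matrix of a product of
factors `S U ^ k` with `0 < k < 5` has diagonal entries at least `1` and nonpositive entries off
the diagonal (`mat_altWord`). Every element has a normal form built from such a product, from
which one reads off that it fixes `∞` only if it is a power of `T`; and an element of trace `0` is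
conjugate to `S`, because a cyclically reduced product of factors `S U ^ k` has trace at least `2`
in absolute value.

By the free product structure there is a homomorphism `permHom` from `G₅` onto the symmetric group
of `Fin 5` that takes `S` to the transposition of `0` and `4` and `U` to a `5`-cycle. The pentagon
subgroup is the stabilizer of `0` (`mem_pentagonSubgroup_iff`), which gives its index and the
number of its conjugates. The width of the cusp `g ∞` is the length of the cycle of `T` through
the point `g⁻¹ 0`; as `T` acts as a `4`-cycle, the level is `4`. The elliptic points are the `g i`
such that `S` fixes `g⁻¹ 0`, and the three orbits correspond to the fixed points of `S`.

If the pentagon subgroup contained a principal congruence subgroup, then `permHom` would be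
trivial on some `H(n)` with `n` a positive integer, because every nonzero element of `ℤ[λ]`
divides one. It is also trivial on `T ^ 4`, and `H₅` is the normal closure of `T`, so the odd part
of `n` can be removed (`principalH_two_pow_le`). But `H₅ / H(2 ^ k)` is solvable: the image of
`H₅` modulo `2` is dihedral, and the successive quotients of the `H(2 ^ k)` are abelian
(`derivedSeries_le_principalH`). So the symmetric group on five letters would be solvable.

For the modular group, a subgroup of index at most `6` gives permutations `s`, `t` of six points,
the images of `S` and `T`. A finite check shows that, for `N` one of `4`, `5`, `6`, they satisfy
`t ^ N = 1` and at most two further relations, whose relators together with `-1` generate the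
group of matrices that are scalar modulo `N` as a normal subgroup. The latter is proved by a coset
enumeration over the cusps of `Γ(N)` (`CuspTable.Valid.Gamma_le_ker`).
-/

namespace HeckeFive

open scoped MatrixGroups UpperHalfPlane OnePoint commutatorElement

/-! ### Cusp tables for the modular group -/

/-- The matrices of `SL(2, ℤ)` that are scalar modulo `N`. -/
def scalarMod (N : ℕ) : Subgroup SL(2, ℤ) :=
  (Subgroup.center SL(2, ZMod N)).comap
    (Matrix.SpecialLinearGroup.map (Int.castRingHom (ZMod N)))

instance scalarMod_normal (N : ℕ) : (scalarMod N).Normal := by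
  unfold scalarMod; infer_instance

theorem mem_scalarMod {N : ℕ} {A : SL(2, ℤ)} :
    A ∈ scalarMod N ↔ (N : ℤ) ∣ A 0 1 ∧ (N : ℤ) ∣ A 1 0 ∧ (N : ℤ) ∣ A 0 0 - A 1 1 := by
  rw [scalarMod, Subgroup.mem_comap, Matrix.SpecialLinearGroup.mem_center_iff]
  simp only [← ZMod.intCast_zmod_eq_zero_iff_dvd, Int.cast_sub, sub_eq_zero]
  have hdet := congrArg (Int.cast : ℤ → ZMod N) A.det_coe
  rw [Matrix.det_fin_two] at hdet
  push_cast at hdet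
  constructor
  · rintro ⟨r, -, hr⟩
    have h := fun i j => congrFun (congrFun hr i) j
    have h00 := h 0 0
    have h01 := h 0 1
    have h10 := h 1 0
    have h11 := h 1 1
    simp at h00 h01 h10 h11
    exact ⟨h01.symm, h10.symm, h00 ▸ h11⟩
  · rintro ⟨h01, h10, h00⟩
    refine ⟨(A 0 0 : ZMod N), ?_, ?_⟩
    · rw [h01, h10, ← h00] at hdet
      rw [Fintype.card_fin]
      linear_combination hdet
    · generalize hr : (A 0 0 : ZMod N) = r at h00
      rw [Matrix.scalar_apply]
      ext i j
      fin_cases i <;> fin_cases j <;> simp [h01, h10, h00, hr]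

instance (N : ℕ) (A : SL(2, ℤ)) : Decidable (A ∈ scalarMod N) :=
  decidable_of_iff _ mem_scalarMod.symm

theorem Gamma_le_scalarMod (N : ℕ) : CongruenceSubgroup.Gamma N ≤ scalarMod N := by
  intro A hA
  rw [scalarMod, Subgroup.mem_comap]
  rw [CongruenceSubgroup.Gamma_mem'] at hA
  erw [hA]
  exact one_mem _

/-- A finite table recording the right action of the generators `S`, `T` on the cosets
`±Γ(N)⟨T⟩ \ SL(2, ℤ)`, which correspond to the cusps of `Γ(N)`. The `i`-th coset is represented by
the product of the `S T ^ a` for `a` in `exps i`; right multiplication by `S` takes it to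
`T ^ shiftS i` times the representative of index `nextS i`, and likewise for `T`. Modulo `±1` and
conjugates of `T ^ N` these relations hold in `SL(2, ℤ)`, apart from those for `T` at the indices in
`extra`. -/
structure CuspTable where
  N : ℕ
  k : ℕ
  exps : Fin (k + 1) → List ℤ
  nextS : Fin (k + 1) → Fin (k + 1)
  shiftS : Fin (k + 1) → ℤ
  nextT : Fin (k + 1) → Fin (k + 1)
  shiftT : Fin (k + 1) → ℤ
  extra : List (Fin (k + 1))

namespace CuspTable

variable (c : CuspTable) {G H : Type*} [Group G] [Group H]

/-- The `i`-th coset representative, evaluated at elements `s`, `t` of any group. -/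
def word (s t : G) (i : Fin (c.k + 1)) : G := ((c.exps i).map fun a => s * t ^ a).prod

/-- The elements `s`, `t` satisfy `t ^ N = 1` and the exceptional relations of the table. -/
def Holds (s t : G) : Prop :=
  t ^ c.N = 1 ∧ ∀ i ∈ c.extra,
    c.word s t i * t = t ^ c.shiftT i * c.word s t (c.nextT i)

instance [DecidableEq G] (s t : G) : Decidable (c.Holds s t) := by
  unfold Holds; infer_instance

/-- The representatives of the cosets, as matrices. -/
abbrev rep (i : Fin (c.k + 1)) : SL(2, ℤ) := c.word ModularGroup.S ModularGroup.T i

/-- The error of the relation for `S` at the index `i`. -/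
abbrev relS (i : Fin (c.k + 1)) : SL(2, ℤ) :=
  c.rep i * ModularGroup.S * (ModularGroup.T ^ c.shiftS i * c.rep (c.nextS i))⁻¹

/-- The error of the relation for `T` at the index `i`. -/
abbrev relT (i : Fin (c.k + 1)) : SL(2, ℤ) :=
  c.rep i * ModularGroup.T * (ModularGroup.T ^ c.shiftT i * c.rep (c.nextT i))⁻¹

/-- Up to sign, `P` is trivial or a conjugate of `T ^ N` or `T ^ (-N)` by a representative. -/
abbrev IsPowConj (P : SL(2, ℤ)) : Prop :=
  ∃ i, ∃ e ∈ [0, (c.N : ℤ), -(c.N : ℤ)],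
    P = (c.rep i)⁻¹ * ModularGroup.T ^ e * c.rep i ∨
      P = -1 * ((c.rep i)⁻¹ * ModularGroup.T ^ e * c.rep i)

/-- The table is correct: its relations hold in `SL(2, ℤ)` modulo `N` up to scalars, the
non-exceptional ones for the reason stated in `CuspTable`; the representative of index `0` is `1`,
and no other one represents the same coset. -/
def Valid : Prop :=
  0 < c.N ∧ c.exps 0 = [] ∧
  (∀ i, c.IsPowConj (c.relS i) ∧
    (i ∈ c.extra ∧ c.relT i ∈ scalarMod c.N ∨ c.IsPowConj (c.relT i))) ∧
  ∀ i, i ≠ 0 → ¬ ((c.N : ℤ) ∣ c.rep i 1 0 ∧ (c.N : ℤ) ∣ c.rep i 1 1 ^ 2 - 1)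

instance : Decidable c.Valid := by
  unfold Valid; infer_instance

theorem map_word (f : G →* H) (s t : G) (i : Fin (c.k + 1)) :
    f (c.word s t i) = c.word (f s) (f t) i := by
  simp [word, map_list_prod, List.map_map, Function.comp_def]

variable {c}

theorem Holds.conj {s t : G} (h : c.Holds s t) (g : G) :
    c.Holds (g * s * g⁻¹) (g * t * g⁻¹) := by
  have hw := fun i => c.map_word (MulAut.conj g).toMonoidHom s t i
  simp only [MulEquiv.coe_toMonoidHom, MulAut.conj_apply] at hw
  refine ⟨by rw [conj_pow, h.1]; group, fun i hi => ?_⟩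
  rw [← hw, ← hw, conj_zpow, conj_mul, conj_mul, h.2 i hi]

theorem Holds.of_map_injective {f : G →* H} (hf : Function.Injective f) {s t : G}
    (h : c.Holds (f s) (f t)) : c.Holds s t := by
  refine ⟨hf (by rw [map_pow, map_one, h.1]), fun i hi => hf ?_⟩
  simp only [map_mul, map_zpow, map_word, h.2 i hi]

/-- A homomorphism whose values at `S` and `T` satisfy the relations of a correct table factors
through `SL(2, ℤ / N)`: by the table, every element of `SL(2, ℤ)` is a product `m T ^ j w` with a
representative `w` and with `m` in the intersection of the kernel and `scalarMod N`; it lies in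
`Γ(N)` only if `w = 1` and `N` divides `j`. -/
theorem Valid.Gamma_le_ker (hc : c.Valid) (f : SL(2, ℤ) →* G) (hneg : f (-1) = 1)
    (h : c.Holds (f ModularGroup.S) (f ModularGroup.T)) :
    CongruenceSubgroup.Gamma c.N ≤ f.ker := by
  obtain ⟨hN, h0, hrel, hne⟩ := hc
  set W := c.rep with hW
  have hW0 : W 0 = 1 := by simp [hW, word, h0]
  set M : Subgroup SL(2, ℤ) := f.ker ⊓ scalarMod c.N with hM
  have hMn : M.Normal := by rw [hM]; infer_instance
  have hTN : ModularGroup.T ^ c.N ∈ M := by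
    refine Subgroup.mem_inf.2 ⟨by rw [MonoidHom.mem_ker, map_pow, h.1], ?_⟩
    rw [mem_scalarMod, ← zpow_natCast, ModularGroup.coe_T_zpow]
    simp
  have hnegM : -1 ∈ M := Subgroup.mem_inf.2 ⟨hneg, by simp [mem_scalarMod]⟩
  have hconj : ∀ P, c.IsPowConj P → P ∈ M := by
    rintro P ⟨i, e, he, hP⟩
    have hTe : ModularGroup.T ^ e ∈ M := by
      simp only [List.mem_cons, List.not_mem_nil, or_false] at he
      rcases he with rfl | rfl | rfl
      · exact one_mem _
      · rwa [zpow_natCast]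
      · rw [zpow_neg, zpow_natCast]; exact inv_mem hTN
    have := hMn.conj_mem' _ hTe (c.rep i)
    rcases hP with rfl | rfl
    exacts [this, mul_mem hnegM this]
  have hSrel : ∀ i, c.relS i ∈ M := fun i => hconj _ (hrel i).1
  have hTrel : ∀ i, c.relT i ∈ M := fun i => by
    rcases (hrel i).2 with ⟨hi, hi'⟩ | hi
    · refine Subgroup.mem_inf.2 ⟨?_, hi'⟩
      rw [MonoidHom.mem_ker, map_mul, map_inv, map_mul, map_mul, map_zpow, map_word, map_word,
        h.2 i hi, mul_inv_cancel]
    · exact hconj _ hi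
  let X : Set SL(2, ℤ) := {A | ∃ m ∈ M, ∃ j : ℤ, ∃ i, A = m * (ModularGroup.T ^ j * W i)}
  have hleft : ∀ m ∈ M, ∀ A ∈ X, m * A ∈ X := by
    rintro m hm A ⟨m', hm', j, i, rfl⟩
    exact ⟨m * m', mul_mem hm hm', j, i, by group⟩
  have hstep : ∀ g, (∀ i, ∃ j : ℤ, ∃ i', W i * g * (ModularGroup.T ^ j * W i')⁻¹ ∈ M) →
      ∀ A ∈ X, A * g ∈ X := by
    rintro g hg A ⟨m, hm, j, i, rfl⟩
    obtain ⟨j', i', hp⟩ := hg i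
    refine ⟨_, mul_mem hm (hMn.conj_mem _ hp (ModularGroup.T ^ j)), j + j', i', ?_⟩
    rw [zpow_add]
    group
  have hXS : ∀ A ∈ X, A * ModularGroup.S ∈ X := hstep _ fun i => ⟨_, _, hSrel i⟩
  have hXT : ∀ A ∈ X, A * ModularGroup.T ∈ X := hstep _ fun i => ⟨_, _, hTrel i⟩
  have hXTn : ∀ n : ℕ, ∀ A ∈ X, A * ModularGroup.T ^ n ∈ X := by
    intro n
    induction n with
    | zero => simp
    | succ n ih => intro A hA; rw [pow_succ, ← mul_assoc]; exact hXT _ (ih A hA)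
  have hS4 : ModularGroup.S⁻¹ = ModularGroup.S * ModularGroup.S * ModularGroup.S := by
    decide +kernel
  have hall : ∀ A, A ∈ X := by
    intro A
    have hA : A ∈ Subgroup.closure {ModularGroup.S, ModularGroup.T} := by
      rw [SpecialLinearGroup.SL2Z_generators]; trivial
    induction hA using Subgroup.closure_induction_right with
    | one => exact ⟨1, one_mem _, 0, 0, by simp [hW0]⟩
    | mul_right x hx y hy ih =>
      rcases hy with rfl | rfl
      exacts [hXS _ ih, hXT _ ih]
    | mul_inv_cancel x hx y hy ih =>
      rcases hy with rfl | rfl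
      · rw [hS4, ← mul_assoc, ← mul_assoc]
        exact hXS _ (hXS _ (hXS _ ih))
      · have : x * ModularGroup.T⁻¹ = (x * (ModularGroup.T ^ c.N)⁻¹ * x⁻¹) *
            (x * ModularGroup.T ^ (c.N - 1)) := by
          obtain ⟨n, hn⟩ : ∃ n, c.N = n + 1 := ⟨c.N - 1, by omega⟩
          rw [hn, Nat.add_sub_cancel, pow_succ]
          group
        rw [this]
        exact hleft _ (hMn.conj_mem _ (inv_mem hTN) x) _ (hXTn _ _ ih)
  intro A hA
  obtain ⟨m, hm, j, i, rfl⟩ := hall A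
  have hB : ModularGroup.T ^ j * W i ∈ scalarMod c.N :=
    (Subgroup.mul_mem_cancel_left _ (Subgroup.mem_inf.1 hm).2).1 (Gamma_le_scalarMod _ hA)
  have hdet := (ModularGroup.T ^ j * W i).det_coe
  rw [mem_scalarMod] at hB
  have e10 : (ModularGroup.T ^ j * W i) 1 0 = W i 1 0 := by
    simp
  have e11 : (ModularGroup.T ^ j * W i) 1 1 = W i 1 1 := by
    simp
  obtain ⟨hB01, hB10, hB00⟩ := hB
  have hi : i = 0 := by
    by_contra hi
    refine hne i hi ⟨e10 ▸ hB10, ?_⟩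
    rw [Matrix.det_fin_two] at hdet
    have hd : W i 1 1 ^ 2 - 1 =
        (ModularGroup.T ^ j * W i) 0 1 * (ModularGroup.T ^ j * W i) 1 0 -
        ((ModularGroup.T ^ j * W i) 0 0 - (ModularGroup.T ^ j * W i) 1 1) *
          (ModularGroup.T ^ j * W i) 1 1 := by
      rw [← e11]
      linear_combination hdet
    change (c.N : ℤ) ∣ W i 1 1 ^ 2 - 1
    rw [hd]
    exact dvd_sub (hB01.mul_right _) (hB00.mul_right _)
  subst hi
  rw [hW0, mul_one, ModularGroup.coe_T_zpow] at hB01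
  obtain ⟨q, hq⟩ : (c.N : ℤ) ∣ j := by simpa using hB01
  rw [hW0, mul_one, hq, zpow_mul, zpow_natCast]
  exact mul_mem (Subgroup.mem_inf.1 hm).1 (zpow_mem (Subgroup.mem_inf.1 hTN).1 q)

end CuspTable

/-- The six cusps of `Γ(4)`. There is no exceptional relation: `±Γ(4)` is generated by `±1` and the
conjugates of `T ^ 4`. -/
def cuspTable4 : CuspTable where
  N := 4
  k := 5
  exps := ![[], [0], [1], [-1], [2], [2, 0]]
  nextS := ![1, 0, 3, 2, 5, 4]
  shiftS := ![0, 0, -1, 1, 0, 0]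
  nextT := ![0, 2, 4, 1, 3, 5]
  shiftT := ![1, 0, 0, 0, 0, -1]
  extra := []

/-- The twelve cusps of `Γ(5)`. -/
def cuspTable5 : CuspTable where
  N := 5
  k := 11
  exps := ![[], [0], [1], [-1], [2], [-2], [2, 0], [2, 1], [2, -1], [2, 2], [2, -2], [2, -2, 0]]
  nextS := ![1, 0, 3, 2, 6, 7, 4, 5, 9, 8, 11, 10]
  shiftS := ![0, 0, -1, 1, 0, 1, 0, -1, 1, -1, 0, 0]
  nextT := ![0, 2, 4, 1, 5, 3, 7, 9, 6, 10, 8, 11]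
  shiftT := ![1, 0, 0, 0, 0, 0, 0, 0, 0, 0, 0, -1]
  extra := [11]

/-- The twelve cusps of `Γ(6)`. Exceptional relations are unavoidable here, since the conjugates of
`T ^ 6` generate a subgroup of infinite index. -/
def cuspTable6 : CuspTable where
  N := 6
  k := 11
  exps := ![[], [0], [1], [-1], [2], [-2], [3], [2, 0], [2, 1], [2, -1], [3, 0], [3, 1]]
  nextS := ![1, 0, 3, 2, 7, 8, 10, 4, 5, 11, 6, 9]
  shiftS := ![0, 0, -1, 1, 0, 1, 0, 0, -1, 0, 0, 0]
  nextT := ![0, 2, 4, 1, 6, 3, 5, 8, 9, 7, 11, 10]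
  shiftT := ![1, 0, 0, 0, 0, 0, 0, 0, 3, 0, 0, 2]
  extra := [8, 11]

theorem cuspTable4_valid : cuspTable4.Valid := by decide +kernel

theorem cuspTable5_valid : cuspTable5.Valid := by decide +kernel

theorem cuspTable6_valid : cuspTable6.Valid := by decide +kernel

/-! ### Subgroups of small index in the modular group -/

/-- The elements `s`, `t` satisfy the relations of one of the three tables. -/
def SomeTableHolds {G : Type*} [Group G] (s t : G) : Prop :=
  cuspTable4.Holds s t ∨ cuspTable5.Holds s t ∨ cuspTable6.Holds s t

instance {G : Type*} [Group G] [DecidableEq G] (s t : G) : Decidable (SomeTableHolds s t) := by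
  unfold SomeTableHolds; infer_instance

theorem someTableHolds_of_involution : ∀ s : Equiv.Perm (Fin 6), s * s = 1 →
    SomeTableHolds s (s * 1) ∧ SomeTableHolds s (s * c[0, 1, 2]) ∧
      SomeTableHolds s (s * (c[0, 1, 2] * c[3, 4, 5])) := by
  decide +kernel

/-- Up to conjugation, `u` is `1`, a `3`-cycle or a product of two `3`-cycles, so that a finite
check suffices. -/
theorem someTableHolds_of_perm (s u : Equiv.Perm (Fin 6)) (hs : s * s = 1) (hu : u ^ 3 = 1) :
    SomeTableHolds s (s * u) := by
  have key : ∀ v : Equiv.Perm (Fin 6), u.cycleType = v.cycleType →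
      (∀ s : Equiv.Perm (Fin 6), s * s = 1 → SomeTableHolds s (s * v)) →
      SomeTableHolds s (s * u) := by
    intro v hv h
    obtain ⟨g, rfl⟩ := isConj_iff.1 (Equiv.Perm.isConj_iff_cycleType_eq.2 hv.symm)
    have hs' : (g⁻¹ * s * g) * (g⁻¹ * s * g) = 1 := by
      rw [show (g⁻¹ * s * g) * (g⁻¹ * s * g) = g⁻¹ * (s * s) * g by group, hs]
      group
    have e1 : g * (g⁻¹ * s * g) * g⁻¹ = s := by group
    have e2 : g * (g⁻¹ * s * g * v) * g⁻¹ = s * (g * v * g⁻¹) := by group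
    rw [← e2]
    nth_rw 1 [← e1]
    exact (h _ hs').imp (fun h => h.conj g) (fun h => h.imp (fun h => h.conj g) fun h => h.conj g)
  have hcard : ∀ v : Equiv.Perm (Fin 6), v ^ 3 = 1 →
      v.cycleType = Multiset.replicate v.cycleType.card 3 ∧
        v.cycleType.card * 3 = v.support.card := fun v hv => by
    have h := Equiv.Perm.cycleType_of_pow_prime_eq_one (p := 3) hv
    refine ⟨h, ?_⟩
    have h' := congrArg Multiset.sum h
    rw [Equiv.Perm.sum_cycleType, Multiset.sum_replicate, smul_eq_mul] at h'
    exact h'.symm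
  have hle : u.support.card ≤ 6 := (Finset.card_le_univ _).trans (by simp)
  have key' : ∀ v : Equiv.Perm (Fin 6), v ^ 3 = 1 → u.support.card = v.support.card →
      u.cycleType = v.cycleType := fun v hv h => by
    obtain ⟨h1, h2⟩ := hcard u hu
    obtain ⟨h3, h4⟩ := hcard v hv
    rw [h1, h3, show u.cycleType.card = v.cycleType.card by omega]
  obtain ⟨h1, h2⟩ := hcard u hu
  have : u.support.card = 0 ∨ u.support.card = 3 ∨ u.support.card = 6 := by omega
  rcases this with h | h | h
  · exact key 1 (key' 1 (by decide) (by simpa using h)) fun s hs =>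
      (someTableHolds_of_involution s hs).1
  · exact key _ (key' _ (by decide) (by rw [h]; decide)) fun s hs =>
      (someTableHolds_of_involution s hs).2.1
  · exact key _ (key' _ (by decide) (by rw [h]; decide)) fun s hs =>
      (someTableHolds_of_involution s hs).2.2

/-- The image of `T` in the permutation group of at most six cosets has order at most `6`, and in
each case the relations of one of the three tables hold there. -/
theorem exists_Gamma_le_of_index_le_six (K : Subgroup SL(2, ℤ)) (hneg : -1 ∈ K)
    (h0 : K.index ≠ 0) (h6 : K.index ≤ 6) :
    ∃ N : ℕ, N ≠ 0 ∧ CongruenceSubgroup.Gamma N ≤ K := by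
  have hfin : Finite (SL(2, ℤ) ⧸ K) := Nat.finite_of_card_ne_zero h0
  obtain ⟨ι⟩ : Nonempty ((SL(2, ℤ) ⧸ K) ↪ Fin 6) := by
    have := Fintype.ofFinite (SL(2, ℤ) ⧸ K)
    refine Function.Embedding.nonempty_of_card_le ?_
    rw [← Nat.card_eq_fintype_card, Fintype.card_fin]
    exact h6
  set f := MulAction.toPermHom SL(2, ℤ) (SL(2, ℤ) ⧸ K) with hf
  have hker : f.ker ≤ K := by
    rw [hf, ← Subgroup.normalCore_eq_ker]; exact K.normalCore_le
  have hneg' : f (-1) = 1 := by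
    rw [← MonoidHom.mem_ker, hf, ← Subgroup.normalCore_eq_ker]
    intro b
    rwa [mul_neg_one, neg_mul, mul_inv_cancel]
  set g := (Equiv.Perm.viaEmbeddingHom ι).comp f with hg
  have hSS : g ModularGroup.S * g ModularGroup.S = 1 := by
    rw [← map_mul, show ModularGroup.S * ModularGroup.S = -1 by decide +kernel, hg,
      MonoidHom.comp_apply, hneg', map_one]
  have hST : g (ModularGroup.S * ModularGroup.T) ^ 3 = 1 := by
    rw [← map_pow, show (ModularGroup.S * ModularGroup.T) ^ 3 = -1 by decide +kernel, hg,
      MonoidHom.comp_apply, hneg', map_one]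
  have h := someTableHolds_of_perm _ _ hSS hST
  rw [map_mul, ← mul_assoc, hSS, one_mul] at h
  have hinj := Equiv.Perm.viaEmbeddingHom_injective ι
  rcases h with h | h | h
  · exact ⟨4, by norm_num, (cuspTable4_valid.Gamma_le_ker f hneg' (h.of_map_injective hinj)).trans
      hker⟩
  · exact ⟨5, by norm_num, (cuspTable5_valid.Gamma_le_ker f hneg' (h.of_map_injective hinj)).trans
      hker⟩
  · exact ⟨6, by norm_num, (cuspTable6_valid.Gamma_le_ker f hneg' (h.of_map_injective hinj)).trans
      hker⟩

theorem isCongruencePSL_of_index_le_six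
    (K : Subgroup (Matrix.ProjectiveSpecialLinearGroup (Fin 2) ℤ)) (h0 : K.index ≠ 0)
    (h6 : K.index ≤ 6) : IsCongruencePSL K := by
  have hsurj := QuotientGroup.mk'_surjective (Subgroup.center SL(2, ℤ))
  have hidx := K.index_comap_of_surjective hsurj
  obtain ⟨N, hN, h⟩ := exists_Gamma_le_of_index_le_six
    (K.comap (QuotientGroup.mk' (Subgroup.center SL(2, ℤ)))) (by
      rw [Subgroup.mem_comap]
      convert one_mem K
      rw [← MonoidHom.mem_ker, QuotientGroup.ker_mk']
      refine Subgroup.mem_center_iff.2 fun g => ?_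
      rw [mul_neg_one, neg_one_mul]) (hidx ▸ h0) (hidx ▸ h6)
  exact ⟨N, hN, Subgroup.map_le_iff_le_comap.2 h⟩

/-! ### Words in a group generated by an involution and an element of order five -/

section Words

variable {G : Type*} [Group G]

/-- The product of the `s * u ^ k` for `k` in the list `l`. -/
def altWord (s u : G) (l : List ℕ) : G := (l.map fun k => s * u ^ k).prod

/-- All letters of the list are nonzero exponents modulo `5`. -/
def IsReduced (l : List ℕ) : Prop := ∀ k ∈ l, 0 < k ∧ k < 5

theorem isReduced_nil : IsReduced [] := by simp [IsReduced]

theorem isReduced_cons {k : ℕ} {l : List ℕ} :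
    IsReduced (k :: l) ↔ (0 < k ∧ k < 5) ∧ IsReduced l := List.forall_mem_cons

theorem isReduced_concat {k : ℕ} {l : List ℕ} :
    IsReduced (l ++ [k]) ↔ IsReduced l ∧ 0 < k ∧ k < 5 := by
  simp only [IsReduced, List.forall_mem_append, List.forall_mem_singleton]

@[simp] theorem altWord_nil (s u : G) : altWord s u [] = 1 := rfl

@[simp] theorem altWord_cons (s u : G) (k : ℕ) (l : List ℕ) :
    altWord s u (k :: l) = s * u ^ k * altWord s u l := by simp [altWord]

theorem altWord_concat (s u : G) (l : List ℕ) (k : ℕ) :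
    altWord s u (l ++ [k]) = altWord s u l * (s * u ^ k) := by simp [altWord]

theorem map_altWord {H : Type*} [Group H] (f : G →* H) (s u : G) (l : List ℕ) :
    f (altWord s u l) = altWord (f s) (f u) l := by
  simp [altWord, map_list_prod, List.map_map, Function.comp_def]

theorem altWord_of_forall_eq (s u : G) {k : ℕ} {l : List ℕ} (h : ∀ k' ∈ l, k' = k) :
    altWord s u l = (s * u ^ k) ^ l.length := by
  rw [List.eq_replicate_of_mem h, altWord, List.map_replicate, List.prod_replicate,
    List.length_replicate]

theorem pow_mod_five {u : G} (hu : u ^ 5 = 1) (n : ℕ) : u ^ (n % 5) = u ^ n := by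
  conv_rhs => rw [← Nat.div_add_mod n 5, pow_add, pow_mul, hu, one_pow, one_mul]

/-- The normal form of an element: a power of `u`, then an alternating word, then possibly `s`. -/
theorem exists_eq_altWord {s u : G} (hs : s * s = 1) (hu : u ^ 5 = 1)
    (hgen : Subgroup.closure {s, u} = ⊤) (g : G) :
    ∃ a < 5, ∃ l, IsReduced l ∧
      (g = u ^ a * altWord s u l ∨ g = u ^ a * altWord s u l * s) := by
  let X : Set G := {g | ∃ a < 5, ∃ l, IsReduced l ∧
      (g = u ^ a * altWord s u l ∨ g = u ^ a * altWord s u l * s)}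
  have hXs : ∀ g ∈ X, g * s ∈ X := by
    rintro g ⟨a, ha, l, hl, rfl | rfl⟩
    · exact ⟨a, ha, l, hl, Or.inr rfl⟩
    · exact ⟨a, ha, l, hl, Or.inl (by rw [mul_assoc, hs, mul_one])⟩
  have hXu : ∀ g ∈ X, g * u ∈ X := by
    rintro g ⟨a, ha, l, hl, rfl | rfl⟩
    · rcases List.eq_nil_or_concat' l with rfl | ⟨l, k, rfl⟩
      · exact ⟨(a + 1) % 5, Nat.mod_lt _ (by norm_num), [], hl,
          Or.inl (by rw [pow_mod_five hu, altWord_nil, mul_one, mul_one, pow_succ])⟩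
      · obtain ⟨hl', hk⟩ := isReduced_concat.1 hl
        by_cases h4 : k = 4
        · subst h4
          refine ⟨a, ha, l, hl', Or.inr ?_⟩
          simp only [altWord_concat, mul_assoc, ← pow_succ, hu, mul_one]
        · refine ⟨a, ha, l ++ [k + 1], isReduced_concat.2 ⟨hl', by omega, by omega⟩, Or.inl ?_⟩
          simp only [altWord_concat, mul_assoc, pow_succ]
    · refine ⟨a, ha, l ++ [1], isReduced_concat.2 ⟨hl, by norm_num⟩, Or.inl ?_⟩
      rw [altWord_concat, pow_one]
      simp only [mul_assoc]
  change g ∈ X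
  have hg : g ∈ Subgroup.closure {s, u} := by rw [hgen]; trivial
  induction hg using Subgroup.closure_induction_right with
  | one => exact ⟨0, by norm_num, [], isReduced_nil, Or.inl (by simp)⟩
  | mul_right x hx y hy ih =>
    rcases hy with rfl | rfl
    exacts [hXs _ ih, hXu _ ih]
  | mul_inv_cancel x hx y hy ih =>
    rcases hy with rfl | rfl
    · rw [inv_eq_of_mul_eq_one_right hs]
      exact hXs _ ih
    · have : x * y⁻¹ = x * y * y * y * y := by
        rw [mul_inv_eq_iff_eq_mul]
        simp only [mul_assoc]
        rw [← pow_two y, ← pow_succ', ← pow_succ', ← pow_succ', hu, mul_one]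
      rw [this]
      exact hXu _ (hXu _ (hXu _ (hXu _ ih)))

/-- Every element is conjugate to a power of `u`, to `s` or to a reduced alternating word: a word
of minimal length in the conjugacy class is cyclically reduced. -/
theorem exists_isConj_altWord {s u : G} (hs : s * s = 1) (hu : u ^ 5 = 1)
    (hgen : Subgroup.closure {s, u} = ⊤) (g : G) :
    ∃ x, IsConj x g ∧ ((∃ a < 5, x = u ^ a) ∨ x = s ∨ ∃ l, IsReduced l ∧ x = altWord s u l) := by
  let good (g : G) : Prop :=
    ∃ x, IsConj x g ∧ ((∃ a < 5, x = u ^ a) ∨ x = s ∨ ∃ l, IsReduced l ∧ x = altWord s u l)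
  have hconj : ∀ g h, IsConj h g → good h → good g :=
    fun g h hgh ⟨x, hx, hx'⟩ => ⟨x, hx.trans hgh, hx'⟩
  have hsinv : s⁻¹ = s := inv_eq_of_mul_eq_one_right hs
  have hcomm : ∀ x y : G, IsConj (x * y) (y * x) := fun x y =>
    isConj_iff.2 ⟨x⁻¹, by group⟩
  -- A word that ends in `s` is conjugate to a shorter one, since the two adjacent `s` cancel.
  have htail : ∀ l, IsReduced l →
      (∀ l', l'.length < l.length → IsReduced l' → ∀ a, good (u ^ a * altWord s u l')) →
      good (altWord s u l * s) := by
    intro l hl ih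
    cases l with
    | nil => exact ⟨s, by rw [altWord_nil, one_mul], Or.inr (Or.inl rfl)⟩
    | cons k l =>
      refine hconj _ _ ?_ (ih l (by simp) (isReduced_cons.1 hl).2 k)
      refine isConj_iff.2 ⟨s, ?_⟩
      rw [altWord_cons, hsinv]
      simp only [mul_assoc]
  have key : ∀ n, ∀ l, l.length = n → IsReduced l → ∀ a, good (u ^ a * altWord s u l) := by
    intro n
    induction n using Nat.strong_induction_on with
    | _ n ih =>
      intro l hln hl a
      rcases List.eq_nil_or_concat' l with rfl | ⟨l, k, rfl⟩
      · exact ⟨_, IsConj.refl _, Or.inl ⟨a % 5, Nat.mod_lt _ (by norm_num),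
          by rw [pow_mod_five hu, altWord_nil, mul_one]⟩⟩
      · obtain ⟨hl', hk⟩ := isReduced_concat.1 hl
        refine hconj _ _ (hcomm _ _) ?_
        rw [altWord_concat, mul_assoc, mul_assoc, ← pow_add, ← pow_mod_five hu]
        by_cases h0 : (k + a) % 5 = 0
        · rw [h0, pow_zero, mul_one]
          refine htail l hl' fun l' hlt hl'' a' => ih _ ?_ l' rfl hl'' a'
          rw [← hln, List.length_append]
          omega
        · refine ⟨_, IsConj.refl _, Or.inr (Or.inr ⟨l ++ [(k + a) % 5], isReduced_concat.2
            ⟨hl', by omega, Nat.mod_lt _ (by norm_num)⟩, (altWord_concat _ _ _ _).symm⟩)⟩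
  obtain ⟨a, ha, l, hl, rfl | rfl⟩ := exists_eq_altWord hs hu hgen g
  · exact key _ l rfl hl a
  · rcases Nat.eq_zero_or_pos a with rfl | ha'
    · rw [pow_zero, one_mul]
      exact htail l hl fun l' _ hl' a' => key _ l' rfl hl' a'
    · refine hconj _ _ (hcomm s _) ⟨_, IsConj.refl _, Or.inr (Or.inr ⟨a :: l,
        isReduced_cons.2 ⟨⟨ha', ha⟩, hl⟩, ?_⟩)⟩
      rw [altWord_cons, mul_assoc]

end Words

/-! ### The matrices of alternating words -/

theorem one_lt_lam : 1 < lam := by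
  have hpos : 0 < lam := by
    rw [← Subtype.coe_lt_coe]
    change 0 < 2 * Real.cos (Real.pi / 5)
    have := Real.cos_pos_of_mem_Ioo (x := Real.pi / 5)
      ⟨by linarith [Real.pi_pos], by linarith [Real.pi_pos]⟩
    linarith
  nlinarith [lam_sq]

/-- The matrix of `A ∈ H₅`. -/
abbrev mat (A : H5) : Matrix (Fin 2) (Fin 2) ZLam := ((A : SL(2, ZLam)) : Matrix _ _ ZLam)

theorem mat_mul (A B : H5) : mat (A * B) = mat A * mat B := rfl

theorem mat_one : mat 1 = 1 := rfl

theorem mat_hS : mat hS = !![0, 1; -1, 0] := rfl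

theorem mat_hT : mat hT = !![1, lam; 0, 1] := rfl

theorem mat_injective : Function.Injective mat :=
  fun _ _ h => Subtype.ext (Subtype.ext h)

theorem mat_det (A : H5) : mat A 0 0 * mat A 1 1 - mat A 0 1 * mat A 1 0 = 1 := by
  have := (A : SL(2, ZLam)).det_coe
  rwa [Matrix.det_fin_two] at this

theorem mat_inv (A : H5) : mat A⁻¹ = !![mat A 1 1, -mat A 0 1; -mat A 1 0, mat A 0 0] := by
  rw [mat, Subgroup.coe_inv, Matrix.SpecialLinearGroup.coe_inv, Matrix.adjugate_fin_two]

theorem mat_hU_pow :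
    mat (hU ^ 0) = !![1, 0; 0, 1] ∧ mat (hU ^ 1) = !![0, 1; -1, lam] ∧
    mat (hU ^ 2) = !![-1, lam; -lam, lam] ∧ mat (hU ^ 3) = !![-lam, lam; -lam, 1] ∧
    mat (hU ^ 4) = !![-lam, 1; -1, 0] ∧ mat (hU ^ 5) = !![-1, 0; 0, -1] := by
  have h := lam_sq
  have hstep : ∀ n a b c d, mat (hU ^ n) = !![a, b; c, d] →
      mat (hU ^ (n + 1)) = !![-b, a + b * lam; -d, c + d * lam] := by
    intro n a b c d hn
    rw [pow_succ, mat_mul, hn, mat, hU_matrix, Matrix.mul_fin_two]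
    apply mat_ext <;> ring
  have h0 : mat (hU ^ 0) = !![1, 0; 0, 1] := by rw [pow_zero, mat_one, Matrix.one_fin_two]
  have h1 : mat (hU ^ 1) = !![0, 1; -1, lam] := by rw [pow_one, mat, hU_matrix]
  have h2 : mat (hU ^ 2) = !![-1, lam; -lam, lam] := by
    rw [hstep 1 _ _ _ _ h1]; apply mat_ext <;> first | ring1 | linear_combination h
  have h3 : mat (hU ^ 3) = !![-lam, lam; -lam, 1] := by
    rw [hstep 2 _ _ _ _ h2]; apply mat_ext <;> first | ring1 | linear_combination h
  have h4 : mat (hU ^ 4) = !![-lam, 1; -1, 0] := by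
    rw [hstep 3 _ _ _ _ h3]; apply mat_ext <;> first | ring1 | linear_combination h
  refine ⟨h0, h1, h2, h3, h4, ?_⟩
  rw [hstep 4 _ _ _ _ h4]; apply mat_ext <;> ring

theorem mat_hS_mul_hU_pow {k : ℕ} (hk : 0 < k ∧ k < 5) :
    ∃ p q r t : ZLam, mat (hS * hU ^ k) = !![-p, q; r, -t] ∧ 1 ≤ p ∧ 0 ≤ q ∧ 0 ≤ r ∧ 1 ≤ t ∧
      (r ≤ 0 → k = 1) ∧ (q ≤ 0 → k = 4) := by
  obtain ⟨-, h1, h2, h3, h4, -⟩ := mat_hU_pow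
  have hl := one_lt_lam
  obtain ⟨hk0, hk5⟩ := hk
  interval_cases k
  · refine ⟨1, lam, 0, 1, ?_, le_rfl, by linarith, le_rfl, le_rfl, by simp, by intro; linarith⟩
    rw [mat_mul, h1, mat_hS, Matrix.mul_fin_two]; apply mat_ext <;> ring
  · refine ⟨lam, lam, 1, lam, ?_, hl.le, by linarith, zero_le_one, hl.le, by intro; linarith,
      by intro; linarith⟩
    rw [mat_mul, h2, mat_hS, Matrix.mul_fin_two]; apply mat_ext <;> ring
  · refine ⟨lam, 1, lam, lam, ?_, hl.le, zero_le_one, by linarith, hl.le, by intro; linarith,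
      by intro; linarith⟩
    rw [mat_mul, h3, mat_hS, Matrix.mul_fin_two]; apply mat_ext <;> ring
  · refine ⟨1, 0, lam, 1, ?_, le_rfl, le_rfl, by linarith, le_rfl, by intro; linarith, by simp⟩
    rw [mat_mul, h4, mat_hS, Matrix.mul_fin_two]; apply mat_ext <;> ring

/-- Up to sign, the matrix of a reduced alternating word has diagonal entries at least `1` and
nonpositive entries off the diagonal: it maps the interval from `∞` to `0` through the negative
numbers into itself. It fixes an end point only if it is a power of a parabolic generator. -/
theorem mat_altWord {l : List ℕ} (hl : IsReduced l) :
    ∃ e a b c d : ZLam, e * e = 1 ∧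
      mat (altWord hS hU l) = !![e * a, -(e * b); -(e * c), e * d] ∧
      1 ≤ a ∧ 0 ≤ b ∧ 0 ≤ c ∧ 1 ≤ d ∧ (c ≤ 0 → ∀ k ∈ l, k = 1) ∧ (b ≤ 0 → ∀ k ∈ l, k = 4) := by
  induction l with
  | nil =>
    refine ⟨1, 1, 0, 0, 1, by ring, ?_, le_rfl, le_rfl, le_rfl, le_rfl, by simp, by simp⟩
    rw [altWord_nil, mat_one, Matrix.one_fin_two]
    apply mat_ext <;> ring
  | cons k l ih =>
    obtain ⟨hk, hl⟩ := isReduced_cons.1 hl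
    obtain ⟨e, a, b, c, d, he, hm, ha, hb, hc, hd, hc1, hb4⟩ := ih hl
    obtain ⟨p, q, r, t, hm', hp, hq, hr, ht, hr1, hq4⟩ := mat_hS_mul_hU_pow hk
    have hpa : 1 ≤ p * a := one_le_mul_of_one_le_of_one_le hp ha
    have htd : 1 ≤ t * d := one_le_mul_of_one_le_of_one_le ht hd
    have hqc : 0 ≤ q * c := mul_nonneg hq hc
    have hrb : 0 ≤ r * b := mul_nonneg hr hb
    have hra : r ≤ r * a := le_mul_of_one_le_right hr ha
    have hqd : q ≤ q * d := le_mul_of_one_le_right hq hd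
    have htc : c ≤ t * c := le_mul_of_one_le_left hc ht
    have hpb : b ≤ p * b := le_mul_of_one_le_left hb hp
    refine ⟨-e, p * a + q * c, p * b + q * d, r * a + t * c, r * b + t * d, by rw [neg_mul_neg, he],
      ?_, by linarith, by linarith, by linarith, by linarith, fun h => ?_, fun h => ?_⟩
    · rw [altWord_cons, mat_mul, hm', hm, Matrix.mul_fin_two]
      apply mat_ext <;> ring
    · exact List.forall_mem_cons.2 ⟨hr1 (by linarith), hc1 (by linarith)⟩
    · exact List.forall_mem_cons.2 ⟨hq4 (by linarith), hb4 (by linarith)⟩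

theorem eq_zero_of_sign_mul {e x : ZLam} (he : e * e = 1) (h : e * x = 0) : x = 0 := by
  rw [← one_mul x, ← he, mul_assoc, h, mul_zero]

/-- A normal form that does not end in `S` fixes `∞` only if it is a power of `S U`. -/
theorem eq_one_of_lower_left_eq_zero {a : ℕ} (ha : a < 5) {l : List ℕ} (hl : IsReduced l)
    (h : mat (hU ^ a * altWord hS hU l) 1 0 = 0) : a = 0 ∧ ∀ k ∈ l, k = 1 := by
  obtain ⟨e, p, q, r, t, he, hm, hp, hq, hr, ht, hr1, -⟩ := mat_altWord hl
  obtain ⟨h0, h1, h2, h3, h4, -⟩ := mat_hU_pow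
  have hlam := one_lt_lam
  have hlp : 0 < lam * p := by positivity
  have hlr : 0 ≤ lam * r := by positivity
  have aux : ∀ x y z w : ZLam, mat (hU ^ a) = !![x, y; z, w] → z * p - w * r = 0 := by
    intro x y z w hxy
    refine eq_zero_of_sign_mul he ?_
    rw [mat_mul, hxy, hm, Matrix.mul_fin_two] at h
    simp only [Matrix.of_apply, Matrix.cons_val', Matrix.cons_val_zero, Matrix.cons_val_one,
      Matrix.cons_val_fin_one] at h
    linear_combination h
  interval_cases a
  · have := aux _ _ _ _ h0
    exact ⟨rfl, hr1 (by linarith)⟩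
  · have := aux _ _ _ _ h1; linarith
  · have := aux _ _ _ _ h2; linarith
  · have := aux _ _ _ _ h3; linarith
  · have := aux _ _ _ _ h4; linarith

/-- A normal form that ends in `S` fixes `∞` only if it is a power of `U⁻¹ S`. -/
theorem eq_four_of_lower_left_eq_zero {a : ℕ} (ha : a < 5) {l : List ℕ} (hl : IsReduced l)
    (h : mat (hU ^ a * altWord hS hU l * hS) 1 0 = 0) : a = 4 ∧ ∀ k ∈ l, k = 4 := by
  obtain ⟨e, p, q, r, t, he, hm, hp, hq, hr, ht, -, hq4⟩ := mat_altWord hl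
  obtain ⟨h0, h1, h2, h3, h4, -⟩ := mat_hU_pow
  have hlam := one_lt_lam
  have hlt : 0 < lam * t := by positivity
  have hlq : 0 ≤ lam * q := by positivity
  have aux : ∀ x y z w : ZLam, mat (hU ^ a) = !![x, y; z, w] → z * q - w * t = 0 := by
    intro x y z w hxy
    refine eq_zero_of_sign_mul he ?_
    rw [mat_mul, mat_mul, hxy, hm, mat_hS, Matrix.mul_fin_two, Matrix.mul_fin_two] at h
    simp only [Matrix.of_apply, Matrix.cons_val', Matrix.cons_val_zero, Matrix.cons_val_one,
      Matrix.cons_val_fin_one] at h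
    linear_combination h
  interval_cases a
  · have := aux _ _ _ _ h0; linarith
  · have := aux _ _ _ _ h1; linarith
  · have := aux _ _ _ _ h2; linarith
  · have := aux _ _ _ _ h3; linarith
  · have := aux _ _ _ _ h4
    exact ⟨rfl, hq4 (by linarith)⟩

/-! ### The structure of `G₅` -/

theorem proj_eq_iff (A B : H5) :
    proj A = proj B ↔ mat A = mat B ∨ mat A = -mat B := by
  have hneg : mat (hS ^ 2) = -1 := congrArg Subtype.val hS_sq
  have hz : Z5 = Subgroup.zpowers (hS ^ 2) := by
    ext x
    rw [Z5, Subgroup.mem_subgroupOf, ← hS_sq, Subgroup.mem_zpowers_iff, Subgroup.mem_zpowers_iff]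
    simp only [← Subgroup.coe_zpow, SetLike.coe_eq_coe]
  have h4 : (hS ^ 2) ^ 2 = 1 := mat_injective (by
    rw [pow_two, mat_mul, hneg, mat_one, neg_mul_neg, one_mul])
  rw [proj, QuotientGroup.mk'_apply, QuotientGroup.mk'_apply, eq_comm, QuotientGroup.eq, hz,
    Subgroup.mem_zpowers_iff]
  constructor
  · rintro ⟨k, hk⟩
    rw [eq_inv_mul_iff_mul_eq] at hk
    rcases Int.even_or_odd' k with ⟨m, rfl | rfl⟩
    · left
      rw [← hk, zpow_mul, show ((hS ^ 2) ^ (2 : ℤ)) = 1 from h4, one_zpow, mul_one]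
    · right
      rw [← hk, zpow_add, zpow_mul, show ((hS ^ 2) ^ (2 : ℤ)) = 1 from h4, one_zpow, one_mul,
        zpow_one, mat_mul, hneg, mul_neg_one]
  · rintro (h | h)
    · exact ⟨0, by rw [mat_injective h, inv_mul_cancel, zpow_zero]⟩
    · refine ⟨1, ?_⟩
      rw [zpow_one, eq_inv_mul_iff_mul_eq]
      exact mat_injective (by rw [mat_mul, hneg, mul_neg_one, h])

theorem proj_surjective : Function.Surjective proj := QuotientGroup.mk'_surjective _

theorem hT_eq : hT = hU⁻¹ * hS := by rw [hU]; group

theorem closure_hS_hT : Subgroup.closure {hS, hT} = ⊤ := by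
  have h : Subgroup.closure ((↑) ⁻¹' ({matS, matT} : Set SL(2, ZLam)) : Set H5) = ⊤ :=
    Subgroup.closure_closure_coe_preimage
  rw [← h]
  congr 1
  ext x
  simp only [Set.mem_insert_iff, Set.mem_singleton_iff, Set.mem_preimage]
  rw [← Subtype.coe_inj, ← Subtype.coe_inj]
  rfl

theorem closure_hS_hU : Subgroup.closure {hS, hU} = ⊤ := by
  rw [eq_top_iff, ← closure_hS_hT, Subgroup.closure_le]
  have h1 : hS ∈ Subgroup.closure {hS, hU} := Subgroup.subset_closure (by simp)
  have h2 : hU ∈ Subgroup.closure {hS, hU} := Subgroup.subset_closure (by simp)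
  rintro x (rfl | rfl)
  · exact h1
  · rw [hT_eq]; exact mul_mem (inv_mem h2) h1

theorem closure_proj : Subgroup.closure {proj hS, proj hU} = ⊤ := by
  rw [← Set.image_pair, ← MonoidHom.map_closure, closure_hS_hU,
    Subgroup.map_top_of_surjective _ proj_surjective]

theorem proj_hS_mul_self : proj hS * proj hS = 1 := by
  rw [← map_mul, ← map_one proj, proj_eq_iff, ← pow_two]
  exact Or.inr (congrArg Subtype.val hS_sq)

theorem proj_hU_pow_five : proj hU ^ 5 = 1 := by
  rw [← map_pow, ← map_one proj, proj_eq_iff]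
  right
  rw [mat_hU_pow.2.2.2.2.2, mat_one]
  ext i j; fin_cases i <;> fin_cases j <;> simp

theorem mat_hT_zpow (j : ℤ) : mat (hT ^ j) = !![1, j * lam; 0, 1] := by
  have hpos : ∀ n : ℕ, mat (hT ^ n) = !![1, n * lam; 0, 1] := by
    intro n
    induction n with
    | zero => rw [pow_zero, mat_one, Matrix.one_fin_two]; apply mat_ext <;> simp
    | succ n ih =>
      rw [pow_succ, mat_mul, ih, mat_hT, Matrix.mul_fin_two]
      apply mat_ext <;> push_cast <;> ring
  obtain ⟨n, rfl | rfl⟩ := j.eq_nat_or_neg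
  · rw [zpow_natCast, hpos]; simp
  · rw [zpow_neg, zpow_natCast, mat_inv, hpos]
    apply mat_ext <;> simp

/-- If a group generated by `s`, `u` with `s ^ 2 = u ^ 5 = 1` maps to `G₅` by `s ↦ S`, `u ↦ U`, then
the elements whose images fix `∞` are the powers of `u⁻¹ s`. -/
theorem exists_zpow_of_lower_left_eq_zero {G : Type*} [Group G] {s u : G} (hs : s * s = 1)
    (hu : u ^ 5 = 1) (hgen : Subgroup.closure {s, u} = ⊤) (F : G →* G5) (hFs : F s = proj hS)
    (hFu : F u = proj hU) {g : G} {A : H5} (hA : F g = proj A) (h0 : mat A 1 0 = 0) :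
    ∃ j : ℤ, g = (u⁻¹ * s) ^ j := by
  have hsinv : s⁻¹ = s := inv_eq_of_mul_eq_one_right hs
  have hlift : ∀ B : H5, F g = proj B → mat B 1 0 = 0 := by
    intro B hB
    rcases (proj_eq_iff A B).1 (hA.symm.trans hB) with h | h
    · rwa [h] at h0
    · rw [h] at h0; simpa using h0
  obtain ⟨a, ha, l, hl, rfl | rfl⟩ := exists_eq_altWord hs hu hgen g
  · obtain ⟨rfl, hl1⟩ := eq_one_of_lower_left_eq_zero ha hl (hlift _ (by
      rw [map_mul, map_mul, map_pow, map_pow, map_altWord, map_altWord, hFs, hFu]))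
    refine ⟨-(l.length : ℤ), ?_⟩
    rw [altWord_of_forall_eq s u hl1, zpow_neg, zpow_natCast, ← inv_pow, mul_inv_rev, inv_inv,
      hsinv,
      pow_zero, one_mul, pow_one]
  · obtain ⟨rfl, hl4⟩ := eq_four_of_lower_left_eq_zero ha hl (hlift _ (by
      rw [map_mul, map_mul, map_mul, map_mul, map_pow, map_pow, map_altWord, map_altWord, hFs,
        hFu]))
    refine ⟨(l.length : ℤ) + 1, ?_⟩
    have hu4 : u ^ 4 = u⁻¹ := eq_inv_of_mul_eq_one_left (by rw [← pow_succ, hu])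
    rw [altWord_of_forall_eq s u hl4, hu4, ← Nat.cast_succ, zpow_natCast, pow_succ]
    have : ∀ n : ℕ, u⁻¹ * (s * u⁻¹) ^ n = (u⁻¹ * s) ^ n * u⁻¹ := by
      intro n
      induction n with
      | zero => simp
      | succ n ih => rw [pow_succ, ← mul_assoc, ih, pow_succ]; group
    rw [this, mul_assoc]

/-- The stabilizer of `∞` in `G₅` consists of the powers of `T`. -/
theorem exists_zpow_of_lower_left_eq_zero' {A : H5} (h0 : mat A 1 0 = 0) :
    ∃ j : ℤ, proj A = proj (hT ^ j) := by
  obtain ⟨j, hj⟩ := exists_zpow_of_lower_left_eq_zero proj_hS_mul_self proj_hU_pow_five closure_proj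
    (MonoidHom.id G5) rfl rfl (g := proj A) rfl h0
  exact ⟨j, by rw [hj, map_zpow, hT_eq, map_mul, map_inv]⟩

theorem proj_hT_zpow_eq_iff (i j : ℤ) : proj (hT ^ i) = proj (hT ^ j) ↔ i = j := by
  refine ⟨fun h => ?_, fun h => h ▸ rfl⟩
  have hl : lam ≠ 0 := (zero_lt_one.trans one_lt_lam).ne'
  rw [proj_eq_iff, mat_hT_zpow, mat_hT_zpow] at h
  rcases h with h | h
  · have := congrFun (congrFun h 0) 1
    simpa [hl] using this
  · have := congrFun (congrFun h 0) 0
    simp at this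
    exfalso; linarith [this.symm ▸ (zero_lt_one (α := ZLam))]

/-- An element of `H₅` of trace `0` is conjugate to `S` in `G₅`. -/
theorem isConj_proj_hS_of_trace_eq_zero {A : H5} (h0 : mat A 0 0 + mat A 1 1 = 0) :
    IsConj (proj hS) (proj A) := by
  obtain ⟨x, hx, hx'⟩ := exists_isConj_altWord proj_hS_mul_self proj_hU_pow_five closure_proj
    (proj A)
  have htr : ∀ X : H5, proj X = x → mat X 0 0 + mat X 1 1 = 0 := by
    rintro X rfl
    obtain ⟨c, hc⟩ := isConj_iff.1 hx
    obtain ⟨C, rfl⟩ := proj_surjective c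
    rw [← map_inv, ← map_mul, ← map_mul, proj_eq_iff] at hc
    have htrace : (mat (C * X * C⁻¹)).trace = (mat X).trace := by
      rw [mat_mul, Matrix.trace_mul_comm, ← mat_mul, ← mul_assoc, inv_mul_cancel, one_mul]
    rw [← Matrix.trace_fin_two] at h0 ⊢
    rcases hc with h | h
    · rw [← htrace, h, h0]
    · rw [← htrace, h, Matrix.trace_neg, h0, neg_zero]
  have hl := one_lt_lam
  rcases hx' with ⟨a, ha, rfl⟩ | rfl | ⟨l, hl', rfl⟩
  · have h := htr (hU ^ a) (map_pow _ _ _)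
    obtain ⟨h0, h1, h2, h3, h4, -⟩ := mat_hU_pow
    exfalso
    interval_cases a
    · rw [h0] at h; simp at h
    · rw [h1] at h; simp at h; linarith
    · rw [h2] at h; simp at h; linarith
    · rw [h3] at h; simp at h; linarith
    · rw [h4] at h; simp at h; linarith
  · exact hx
  · have h := htr (altWord hS hU l) (map_altWord _ _ _ _)
    obtain ⟨e, a, b, c, d, he, hm, ha, -, -, hd, -⟩ := mat_altWord hl'
    rw [hm] at h
    have := eq_zero_of_sign_mul he (x := a + d) (by simpa [mul_add] using h)
    exfalso; linarith

/-- The relators `s ^ 2` and `u ^ 5`. -/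
def heckeRels : Set (FreeGroup Bool) := {FreeGroup.of false ^ 2, FreeGroup.of true ^ 5}

theorem lift_heckeRels {G : Type*} [Group G] {s u : G} (hs : s * s = 1) (hu : u ^ 5 = 1) :
    ∀ r ∈ heckeRels, FreeGroup.lift (fun b => cond b u s) r = 1 := by
  rintro r (rfl | rfl)
  · rw [map_pow, FreeGroup.lift_apply_of, pow_two]; exact hs
  · rw [map_pow, FreeGroup.lift_apply_of]; exact hu

/-- `G₅` is presented by the generators `S`, `U` with the relations `S ^ 2 = U ^ 5 = 1`: an element
of the abstract group in the kernel fixes `∞`, so it is a power of `T`, and `T` has infinite order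
in `G₅`. -/
theorem exists_hom_G5 {G : Type*} [Group G] {s u : G} (hs : s * s = 1) (hu : u ^ 5 = 1) :
    ∃ F : G5 →* G, F (proj hS) = s ∧ F (proj hU) = u := by
  let σ : PresentedGroup heckeRels := PresentedGroup.of false
  let τ : PresentedGroup heckeRels := PresentedGroup.of true
  have hσ : σ * σ = 1 := by
    rw [← pow_two]
    exact PresentedGroup.one_of_mem (Or.inl rfl)
  have hτ : τ ^ 5 = 1 := PresentedGroup.one_of_mem (Or.inr rfl)
  have hgen : Subgroup.closure {σ, τ} = ⊤ := by
    rw [← PresentedGroup.closure_range_of heckeRels]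
    congr 1
    ext x
    simp [σ, τ]
  let F : PresentedGroup heckeRels →* G5 :=
    PresentedGroup.toGroup (lift_heckeRels proj_hS_mul_self proj_hU_pow_five)
  have hFσ : F σ = proj hS := PresentedGroup.toGroup.of _
  have hFτ : F τ = proj hU := PresentedGroup.toGroup.of _
  have hinj : Function.Injective F := by
    rw [injective_iff_map_eq_one]
    intro g hg
    obtain ⟨j, rfl⟩ := exists_zpow_of_lower_left_eq_zero hσ hτ hgen F hFσ hFτ (A := 1)
      (by rw [hg, map_one]) (by simp [mat_one])
    rw [map_zpow, map_mul, map_inv, hFσ, hFτ, ← map_inv, ← map_mul, ← hT_eq, ← map_zpow,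
      ← map_one proj, ← zpow_zero hT, proj_hT_zpow_eq_iff] at hg
    rw [hg, zpow_zero]
  have hsurj : Function.Surjective F := by
    rw [← MonoidHom.range_eq_top, eq_top_iff, ← closure_proj, Subgroup.closure_le]
    rintro x (rfl | rfl)
    exacts [⟨σ, hFσ⟩, ⟨τ, hFτ⟩]
  let e := MulEquiv.ofBijective F ⟨hinj, hsurj⟩
  refine ⟨(PresentedGroup.toGroup (lift_heckeRels hs hu)).comp e.symm.toMonoidHom, ?_, ?_⟩
  · have : e.symm (proj hS) = σ := by rw [MulEquiv.symm_apply_eq]; exact hFσ.symm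
    rw [MonoidHom.comp_apply, MulEquiv.coe_toMonoidHom, this]
    exact PresentedGroup.toGroup.of _
  · have : e.symm (proj hU) = τ := by rw [MulEquiv.symm_apply_eq]; exact hFτ.symm
    rw [MonoidHom.comp_apply, MulEquiv.coe_toMonoidHom, this]
    exact PresentedGroup.toGroup.of _

/-! ### The permutation representation on the cosets of the pentagon subgroup -/

theorem exists_permHom : ∃ F : G5 →* Equiv.Perm (Fin 5),
    F (proj hS) = Equiv.swap 0 4 ∧ F (proj hU) = (finRotate 5)⁻¹ :=
  exists_hom_G5 (by decide) (by decide)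

/-- The action of `G₅` on the cosets of the pentagon subgroup, where `i` stands for the coset of
`U ^ (-i)`. -/
noncomputable def permHom : G5 →* Equiv.Perm (Fin 5) := exists_permHom.choose

theorem permHom_hS : permHom (proj hS) = Equiv.swap 0 4 := exists_permHom.choose_spec.1

theorem permHom_hU : permHom (proj hU) = (finRotate 5)⁻¹ := exists_permHom.choose_spec.2

theorem permHom_hT : permHom (proj hT) = finRotate 5 * Equiv.swap 0 4 := by
  rw [hT_eq, map_mul, map_mul, map_inv, map_inv, permHom_hS, permHom_hU, inv_inv]

theorem permHom_surjective : Function.Surjective permHom := by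
  have h := Equiv.Perm.closure_prime_cycle_swap (σ := finRotate 5) (τ := Equiv.swap 0 4)
    (by rw [Fintype.card_fin]; norm_num) isCycle_finRotate support_finRotate ⟨0, 4, by decide, rfl⟩
  rw [← MonoidHom.range_eq_top, eq_top_iff, ← h, Subgroup.closure_le]
  rintro x (rfl | rfl)
  · exact ⟨(proj hU)⁻¹, by rw [map_inv, permHom_hU, inv_inv]⟩
  · exact ⟨_, permHom_hS⟩

theorem proj_hT_mem : proj hT ∈ pentagonSubgroup := Subgroup.subset_closure (by simp)

theorem sideInvolution_mem {i : ℕ} (hi : 0 < i) (hi' : i < 4) :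
    proj (sideInvolution i) ∈ pentagonSubgroup := by
  refine Subgroup.subset_closure ?_
  interval_cases i <;> simp

/-- The powers of `U` represent the cosets of the pentagon subgroup: in terms of these, the
generators express how right multiplication by `S` permutes the cosets. -/
theorem exists_mem_mul_pow (g : G5) : ∃ k ∈ pentagonSubgroup, ∃ i < 5, g = k * proj hU ^ i := by
  have hu := proj_hU_pow_five
  have hs := proj_hS_mul_self
  let X : Set G5 := {g | ∃ k ∈ pentagonSubgroup, ∃ i < 5, g = k * proj hU ^ i}
  have hT' : proj hT = proj hU ^ 4 * proj hS := by
    rw [hT_eq, map_mul, map_inv, eq_comm, mul_left_inj]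
    exact eq_inv_of_mul_eq_one_left (by rw [← pow_succ, hu])
  have hXu : ∀ g ∈ X, g * proj hU ∈ X := by
    rintro g ⟨k, hk, i, hi, rfl⟩
    exact ⟨k, hk, (i + 1) % 5, Nat.mod_lt _ (by norm_num),
      by rw [pow_mod_five hu, pow_succ, mul_assoc]⟩
  have hXs : ∀ g ∈ X, g * proj hS ∈ X := by
    rintro g ⟨k, hk, i, hi, rfl⟩
    by_cases h0 : i = 0
    · refine ⟨k * (proj hT)⁻¹, mul_mem hk (inv_mem proj_hT_mem), 4, by norm_num, ?_⟩
      rw [h0, pow_zero, mul_one, hT', mul_inv_rev, inv_eq_of_mul_eq_one_right hs]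
      group
    by_cases h4 : i = 4
    · exact ⟨k * proj hT, mul_mem hk proj_hT_mem, 0, by norm_num,
        by rw [h4, hT', pow_zero, mul_one, mul_assoc]⟩
    · refine ⟨k * proj (sideInvolution i),
        mul_mem hk (sideInvolution_mem (by omega) (by omega)), i, hi, ?_⟩
      rw [sideInvolution, map_mul, map_mul, map_inv, map_pow]
      group
  change g ∈ X
  have hg : g ∈ Subgroup.closure {proj hS, proj hU} := by rw [closure_proj]; trivial
  induction hg using Subgroup.closure_induction_right with
  | one => exact ⟨1, one_mem _, 0, by norm_num, by simp⟩
  | mul_right x hx y hy ih =>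
    rcases hy with rfl | rfl
    exacts [hXs _ ih, hXu _ ih]
  | mul_inv_cancel x hx y hy ih =>
    rcases hy with rfl | rfl
    · rw [inv_eq_of_mul_eq_one_right hs]
      exact hXs _ ih
    · have : x * (proj hU)⁻¹ = x * proj hU * proj hU * proj hU * proj hU := by
        rw [inv_eq_of_mul_eq_one_left (a := proj hU ^ 4) (by rw [← pow_succ, hu])]
        simp only [mul_assoc, pow_succ, pow_zero, one_mul]
      rw [this]
      exact hXu _ (hXu _ (hXu _ (hXu _ ih)))

/-- The pentagon subgroup is the stabilizer of the base point. -/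
theorem mem_pentagonSubgroup_iff (g : G5) : g ∈ pentagonSubgroup ↔ permHom g 0 = 0 := by
  have hle : pentagonSubgroup ≤ (MulAction.stabilizer (Equiv.Perm (Fin 5)) (0 : Fin 5)).comap
      permHom := by
    rw [pentagonSubgroup, Subgroup.closure_le]
    rintro x (rfl | rfl | rfl | rfl) <;>
      rw [SetLike.mem_coe, Subgroup.mem_comap, MulAction.mem_stabilizer_iff] <;>
      simp only [sideInvolution, map_mul, map_inv, map_pow, permHom_hT, permHom_hS, permHom_hU] <;>
      decide
  refine ⟨fun h => hle h, fun h => ?_⟩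
  obtain ⟨k, hk, i, hi, rfl⟩ := exists_mem_mul_pow g
  have hk' : permHom k 0 = 0 := hle hk
  rw [map_mul, Equiv.Perm.mul_apply, ← hk', Equiv.apply_eq_iff_eq, map_pow, permHom_hU, hk'] at h
  have : i = 0 := by
    interval_cases i
    · rfl
    all_goals exact absurd h (by decide)
  rw [this, pow_zero, mul_one]
  exact hk

theorem pentagonSubgroup_eq : pentagonSubgroup =
    (MulAction.stabilizer (Equiv.Perm (Fin 5)) (0 : Fin 5)).comap permHom := by
  ext g
  exact mem_pentagonSubgroup_iff g

theorem pentagonSubgroup_index : pentagonSubgroup.index = 5 := by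
  rw [pentagonSubgroup_eq, Subgroup.index_comap_of_surjective _ permHom_surjective,
    MulAction.index_stabilizer_of_transitive, Nat.card_eq_fintype_card, Fintype.card_fin]

theorem pentagonSubgroup_conjugates_ncard :
    {L : Subgroup G5 | ∃ g : G5,
      L = pentagonSubgroup.map (MulAut.conj g).toMonoidHom}.ncard = 5 := by
  let stab (i : Fin 5) : Subgroup G5 :=
    (MulAction.stabilizer (Equiv.Perm (Fin 5)) i).comap permHom
  have hconj : ∀ g, pentagonSubgroup.map (MulAut.conj g).toMonoidHom = stab (permHom g 0) := by
    intro g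
    ext x
    rw [Subgroup.mem_map_equiv, mem_pentagonSubgroup_iff, MulAut.conj_symm_apply, map_mul, map_mul,
      map_inv, Equiv.Perm.mul_apply, Equiv.Perm.mul_apply, Equiv.Perm.inv_eq_iff_eq]
    exact Iff.rfl
  have hrange : {L : Subgroup G5 | ∃ g : G5,
      L = pentagonSubgroup.map (MulAut.conj g).toMonoidHom} = Set.range stab := by
    ext L
    constructor
    · rintro ⟨g, rfl⟩
      exact ⟨_, (hconj g).symm⟩
    · rintro ⟨i, rfl⟩
      obtain ⟨g, hg⟩ := permHom_surjective (Equiv.swap 0 i)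
      exact ⟨g, by rw [hconj, hg, Equiv.swap_apply_left]⟩
  have hinj : Function.Injective stab := by
    intro i j hij
    by_contra hne
    have hk : ∀ i j : Fin 5, ∃ k, i ≠ k ∧ j ≠ k := by decide
    obtain ⟨k, hik, hjk⟩ := hk i j
    obtain ⟨g, hg⟩ := permHom_surjective (Equiv.swap j k)
    have hgi : g ∈ stab i := by
      change permHom g i = i
      rw [hg, Equiv.swap_apply_of_ne_of_ne hne hik]
    rw [hij] at hgi
    have hgj : permHom g j = j := hgi
    rw [hg, Equiv.swap_apply_left] at hgj
    exact hjk hgj.symm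
  rw [hrange, ← Set.image_univ, Set.ncard_image_of_injective _ hinj, Set.ncard_univ, Nat.card_fin]

/-! ### Cusps -/

theorem boundaryAct_mul (g h : H5) (x : OnePoint ℝ) :
    boundaryAct (g * h) x = boundaryAct g (boundaryAct h x) := by
  rw [boundaryAct, Subgroup.coe_mul, map_mul, mul_smul]; rfl

theorem boundaryAct_one (x : OnePoint ℝ) : boundaryAct 1 x = x := by
  rw [boundaryAct, Subgroup.coe_one, map_one, one_smul]

theorem boundaryAct_infty_eq_iff (h : H5) : boundaryAct h ∞ = ∞ ↔ mat h 1 0 = 0 := by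
  rw [boundaryAct, OnePoint.smul_infty_eq_self_iff]
  simp [mat, Algebra.algebraMap_eq_smul_one]

/-- The width of the cusp `g ∞` is the length of the cycle of `T` through the coset of `g⁻¹`, since
the stabilizer of `g ∞` in `G₅` consists of the `g T ^ j g⁻¹`, and distinct powers of `T` are not
conjugate in `G₅`. -/
theorem cuspWidth_boundaryAct (g : H5) :
    cuspWidth pentagonSubgroup (boundaryAct g ∞) =
      sInf {m : ℕ | 0 < m ∧ (permHom (proj hT) ^ m) (permHom (proj g⁻¹) 0) =
        permHom (proj g⁻¹) 0} := by
  rw [cuspWidth]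
  congr 1
  ext m
  refine and_congr_right fun hm => ?_
  constructor
  · rintro ⟨h, hK, hx, hconj⟩
    have hfix : mat (g⁻¹ * h * g) 1 0 = 0 := by
      rw [← boundaryAct_infty_eq_iff, boundaryAct_mul, boundaryAct_mul, hx, ← boundaryAct_mul,
        inv_mul_cancel, boundaryAct_one]
    obtain ⟨j, hj⟩ := exists_zpow_of_lower_left_eq_zero' hfix
    have hconj' : IsConj (proj (hT ^ m)) (proj (hT ^ j)) := by
      refine hconj.trans (isConj_iff.2 ⟨proj g⁻¹, ?_⟩)
      rw [← hj, map_mul, map_mul, map_inv, inv_inv]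
    obtain ⟨c, hc⟩ := isConj_iff.1 hconj'
    obtain ⟨C, rfl⟩ := proj_surjective c
    have hC : mat C 1 0 = 0 := by
      rw [← map_inv, ← map_mul, ← map_mul, ← zpow_natCast, proj_eq_iff] at hc
      -- The lower left entry of this conjugate is `-m λ c ^ 2`, where `c` is that of `C`.
      have h10 : mat (C * hT ^ (m : ℤ) * C⁻¹) 1 0 = 0 := by
        rcases hc with h | h <;> rw [h, mat_hT_zpow] <;> simp
      have e : mat C = !![mat C 0 0, mat C 0 1; mat C 1 0, mat C 1 1] := Matrix.eta_fin_two _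
      rw [mat_mul, mat_mul, mat_hT_zpow, mat_inv, e, Matrix.mul_fin_two, Matrix.mul_fin_two] at h10
      simp only [Matrix.of_apply, Matrix.cons_val', Matrix.cons_val_zero, Matrix.cons_val_one,
        Matrix.cons_val_fin_one] at h10
      have hl : lam ≠ 0 := (zero_lt_one.trans one_lt_lam).ne'
      have : ((m : ℤ) : ZLam) * lam * (mat C 1 0 * mat C 1 0) = 0 := by linear_combination -h10
      simpa [hl, hm.ne'] using this
    obtain ⟨i, hi⟩ := exists_zpow_of_lower_left_eq_zero' hC
    -- The conjugating element is itself a power of `T`, so the conjugate of `T ^ m` is `T ^ m`.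
    have hTm : proj (hT ^ j) = proj (hT ^ m) := by
      rw [← hc, hi, ← map_inv, ← map_mul, ← map_mul]
      congr 1
      group
    have hK' : permHom (proj h) 0 = 0 := (mem_pentagonSubgroup_iff _).1 hK
    have hh : proj hT ^ m = proj g⁻¹ * proj h * proj g := by
      rw [← map_pow, ← hTm, ← hj, map_mul, map_mul]
    rw [← map_pow, hh, ← Equiv.Perm.mul_apply, ← map_mul, mul_assoc, ← map_mul proj g,
      mul_inv_cancel, map_one, mul_one, map_mul, Equiv.Perm.mul_apply, hK']
  · intro h
    refine ⟨g * hT ^ m * g⁻¹, ?_, ?_, isConj_iff.2 ⟨proj g, ?_⟩⟩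
    · rw [mem_pentagonSubgroup_iff]
      simp only [map_mul, map_pow, Equiv.Perm.mul_apply]
      rw [h, ← Equiv.Perm.mul_apply, ← map_mul, ← map_mul, mul_inv_cancel, map_one, map_one,
        Equiv.Perm.one_apply]
    · rw [← boundaryAct_mul, inv_mul_cancel_right, boundaryAct_mul]
      congr 1
      rw [boundaryAct_infty_eq_iff, ← zpow_natCast, mat_hT_zpow]
      simp
    · rw [map_mul, map_mul, map_inv]

theorem cuspWidth_of_eq_zero {g : H5} (h : permHom (proj g⁻¹) 0 = 0) :
    cuspWidth pentagonSubgroup (boundaryAct g ∞) = 1 := by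
  rw [cuspWidth_boundaryAct, h]
  refine IsLeast.csInf_eq ⟨⟨one_pos, ?_⟩, fun m hm => hm.1⟩
  rw [permHom_hT]
  decide

theorem cuspWidth_of_ne_zero {g : H5} (h : permHom (proj g⁻¹) 0 ≠ 0) :
    cuspWidth pentagonSubgroup (boundaryAct g ∞) = 4 := by
  rw [cuspWidth_boundaryAct, permHom_hT]
  have key : ∀ i : Fin 5, i ≠ 0 → ((finRotate 5 * Equiv.swap 0 4 : Equiv.Perm (Fin 5)) ^ 4) i = i ∧
      ∀ m < 4, 0 < m → ((finRotate 5 * Equiv.swap 0 4 : Equiv.Perm (Fin 5)) ^ m) i ≠ i := by decide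
  obtain ⟨h4, hlt⟩ := key _ h
  exact IsLeast.csInf_eq ⟨⟨by norm_num, h4⟩, fun m hm => not_lt.1 fun hm4 => hlt m hm4 hm.1 hm.2⟩

theorem pentagonSubgroup_geometricLevel : geometricLevel pentagonSubgroup = 4 := by
  rw [geometricLevel]
  refine IsLeast.csInf_eq ⟨⟨by norm_num, ?_⟩, ?_⟩
  · rintro x ⟨g, rfl⟩
    by_cases h : permHom (proj g⁻¹) 0 = 0
    · rw [cuspWidth_of_eq_zero h]; norm_num
    · rw [cuspWidth_of_ne_zero h]
  · rintro N ⟨hN, hdvd⟩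
    have h := hdvd _ ⟨hU, rfl⟩
    rw [cuspWidth_of_ne_zero] at h
    · exact Nat.le_of_dvd hN h
    · rw [map_inv, map_inv, permHom_hU]
      decide

/-! ### Elliptic points -/

theorem exists_int_add_int_mul_lam (p : ZLam) : ∃ x y : ℤ, p = x + y * lam := by
  obtain ⟨p, hp⟩ := p
  suffices ∃ x y : ℤ, p = x + y * lamReal by
    obtain ⟨x, y, h⟩ := this
    refine ⟨x, y, Subtype.ext ?_⟩
    simpa [lam] using h
  have hsq : lamReal * lamReal = lamReal + 1 := congrArg Subtype.val lam_sq
  induction hp using Algebra.adjoin_induction with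
  | mem x hx => exact ⟨0, 1, by rw [Set.mem_singleton_iff.1 hx]; simp⟩
  | algebraMap r => exact ⟨r, 0, by simp⟩
  | add x y _ _ hx hy =>
    obtain ⟨a, b, rfl⟩ := hx
    obtain ⟨c, d, rfl⟩ := hy
    exact ⟨a + c, b + d, by push_cast; ring⟩
  | mul x y _ _ hx hy =>
    obtain ⟨a, b, rfl⟩ := hx
    obtain ⟨c, d, rfl⟩ := hy
    exact ⟨a * c + b * d, a * d + b * c + b * d, by push_cast; linear_combination b * d * hsq⟩

theorem int_add_int_mul_lam_eq_zero {x y : ℤ} (h : (x : ZLam) + y * lam = 0) : x = 0 ∧ y = 0 := by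
  have hN : (x * x + x * y - y * y : ℤ) = 0 := by
    have : ((x * x + x * y - y * y : ℤ) : ZLam) = 0 := by
      push_cast
      linear_combination (x + y - y * lam) * h + (y : ZLam) * y * lam_sq
    exact_mod_cast this
  by_cases hy : y = 0
  · subst hy
    exact ⟨by simpa using hN, rfl⟩
  · -- The discriminant `5` of `X ^ 2 + X - 1` is not a square.
    exfalso
    have h5 : Irrational (Real.sqrt 5) := by
      simpa using Nat.Prime.irrational_sqrt (p := 5) (by norm_num)
    have h5' : IsSquare (5 : ℚ) := by
      refine ⟨(2 * x + y) / y, ?_⟩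
      have hy' : (y : ℚ) ≠ 0 := by exact_mod_cast hy
      have hN' : (x * x + x * y - y * y : ℚ) = 0 := by exact_mod_cast hN
      field_simp
      linear_combination -4 * hN'
    obtain ⟨q, hq⟩ := h5'
    refine h5 ⟨|q|, ?_⟩
    have : (5 : ℝ) = (|q| : ℚ) * (|q| : ℚ) := by
      rw [← Rat.cast_mul, abs_mul_abs_self, ← hq]; norm_num
    rw [this, Real.sqrt_mul_self (by positivity)]

/-- The only points on the unit circle with both coordinates in `ℤ[λ]` are the obvious ones, since
the coefficient of `1` in `a ^ 2 + b ^ 2` in the basis `1`, `λ` is a sum of four squares of integers. -/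
theorem eq_zero_of_sq_add_sq_eq_one {a b : ZLam} (h : a * a + b * b = 1) :
    (a = 0 ∧ (b = 1 ∨ b = -1)) ∨ (b = 0 ∧ (a = 1 ∨ a = -1)) := by
  obtain ⟨x, y, rfl⟩ := exists_int_add_int_mul_lam a
  obtain ⟨z, w, rfl⟩ := exists_int_add_int_mul_lam b
  obtain ⟨h1, h2⟩ := int_add_int_mul_lam_eq_zero
    (x := x * x + y * y + z * z + w * w - 1) (y := 2 * x * y + y * y + 2 * z * w + w * w) (by
      push_cast
      linear_combination h - ((y : ZLam) * y + w * w) * lam_sq)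
  have hx : x * x ≤ 1 := by nlinarith [mul_self_nonneg y, mul_self_nonneg z, mul_self_nonneg w]
  have hy : y * y ≤ 1 := by nlinarith [mul_self_nonneg x, mul_self_nonneg z, mul_self_nonneg w]
  have hz : z * z ≤ 1 := by nlinarith [mul_self_nonneg x, mul_self_nonneg y, mul_self_nonneg w]
  have hw : w * w ≤ 1 := by nlinarith [mul_self_nonneg x, mul_self_nonneg y, mul_self_nonneg z]
  have hx1 : -1 ≤ x ∧ x ≤ 1 := abs_le.1 (by nlinarith [abs_mul_abs_self x, abs_nonneg x])
  have hy1 : -1 ≤ y ∧ y ≤ 1 := abs_le.1 (by nlinarith [abs_mul_abs_self y, abs_nonneg y])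
  have hz1 : -1 ≤ z ∧ z ≤ 1 := abs_le.1 (by nlinarith [abs_mul_abs_self z, abs_nonneg z])
  have hw1 : -1 ≤ w ∧ w ≤ 1 := abs_le.1 (by nlinarith [abs_mul_abs_self w, abs_nonneg w])
  clear h hx hy hz hw
  obtain ⟨hx0, hx1⟩ := hx1
  obtain ⟨hy0, hy1⟩ := hy1
  obtain ⟨hz0, hz1⟩ := hz1
  obtain ⟨hw0, hw1⟩ := hw1
  interval_cases x <;> interval_cases y <;> interval_cases z <;> interval_cases w <;>
    first | omega | simp

theorem coe_smul_eq (A : H5) (z : ℍ) : ((A • z : ℍ) : ℂ) =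
    (((mat A 0 0 : ℝ) : ℂ) * z + ((mat A 0 1 : ℝ) : ℂ)) /
      (((mat A 1 0 : ℝ) : ℂ) * z + ((mat A 1 1 : ℝ) : ℂ)) :=
  UpperHalfPlane.coe_specialLinearGroup_apply (A : SL(2, ZLam)) z

theorem smul_eq_of_proj_eq {A B : H5} (h : proj A = proj B) (z : ℍ) : A • z = B • z := by
  refine UpperHalfPlane.ext ?_
  rw [coe_smul_eq, coe_smul_eq]
  rcases (proj_eq_iff A B).1 h with h | h
  · rw [h]
  · rw [h]
    simp only [Matrix.neg_apply, NegMemClass.coe_neg, Complex.ofReal_neg, neg_mul, ← neg_add]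
    rw [neg_div_neg_eq]

theorem hS_smul_eq_self_iff (z : ℍ) : hS • z = z ↔ z = UpperHalfPlane.I := by
  rw [UpperHalfPlane.ext_iff, UpperHalfPlane.ext_iff, coe_smul_eq, mat_hS]
  have hz : (z : ℂ) ≠ 0 := UpperHalfPlane.ne_zero z
  have hzI : (z : ℂ) + Complex.I ≠ 0 := fun h => by
    have := congrArg Complex.im h
    have hpos : 0 < (z : ℂ).im := z.im_pos
    simp only [Complex.add_im, Complex.I_im, Complex.zero_im] at this
    linarith
  have hfac : ((z : ℂ) - Complex.I) * (z + Complex.I) = z * z + 1 := by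
    linear_combination -Complex.I_mul_I
  rw [UpperHalfPlane.coe_I]
  simp only [Matrix.of_apply, Matrix.cons_val', Matrix.cons_val_zero, Matrix.cons_val_one,
      Matrix.cons_val_fin_one, ZeroMemClass.coe_zero, OneMemClass.coe_one, NegMemClass.coe_neg,
      Complex.ofReal_zero, Complex.ofReal_one, Complex.ofReal_neg, zero_mul, zero_add, add_zero]
  constructor
  · intro h
    rw [div_eq_iff (by simpa using hz)] at h
    have h0 : ((z : ℂ) - Complex.I) * (z + Complex.I) = 0 := by
      rw [hfac]; linear_combination h
    exact sub_eq_zero.1 ((mul_eq_zero.1 h0).resolve_right hzI)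
  · intro h
    rw [h, div_eq_iff (by simp)]
    linear_combination Complex.I_mul_I

/-- The stabilizer of `i` in `G₅` consists of `1` and `S`. -/
theorem proj_eq_of_smul_I_eq_I {A : H5} (h : A • UpperHalfPlane.I = UpperHalfPlane.I) :
    proj A = 1 ∨ proj A = proj hS := by
  have hden : (((mat A 1 0 : ℝ) : ℂ) * Complex.I + ((mat A 1 1 : ℝ) : ℂ)) ≠ 0 := by
    intro h0
    have hre := congrArg Complex.re h0
    have him := congrArg Complex.im h0
    simp at hre him
    have := mat_det A
    rw [hre, him] at this
    simp at this
  rw [UpperHalfPlane.ext_iff, coe_smul_eq, UpperHalfPlane.coe_I, div_eq_iff hden] at h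
  have hre := congrArg Complex.re h
  have him := congrArg Complex.im h
  simp at hre him
  have hb : mat A 0 1 = -mat A 1 0 := Subtype.ext (by simpa using hre)
  have ha : mat A 0 0 = mat A 1 1 := Subtype.ext (by simpa using him)
  have hdet := mat_det A
  have e : mat A = !![mat A 0 0, mat A 0 1; mat A 1 0, mat A 1 1] := Matrix.eta_fin_two _
  rw [ha, hb] at e hdet
  have h1 : (!![(-1 : ZLam), 0; 0, -1]) = -1 := by
    ext i j; fin_cases i <;> fin_cases j <;> simp
  rcases eq_zero_of_sq_add_sq_eq_one (a := mat A 1 1) (b := mat A 1 0)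
    (by linear_combination hdet) with ⟨h0, h | h⟩ | ⟨h0, h | h⟩
  · right
    rw [proj_eq_iff, e, h0, h, mat_hS]
    right
    ext i j; fin_cases i <;> fin_cases j <;> simp
  · right
    rw [proj_eq_iff, e, h0, h, mat_hS]
    left
    ext i j; fin_cases i <;> fin_cases j <;> simp
  · left
    rw [← map_one proj, proj_eq_iff, e, h0, h, mat_one, Matrix.one_fin_two, neg_zero]
    exact Or.inl rfl
  · left
    rw [← map_one proj, proj_eq_iff, e, h0, h, mat_one, neg_zero]
    exact Or.inr h1

theorem trace_eq_zero_of_orderOf_eq_two {A : H5} (h : orderOf (proj A) = 2) :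
    mat A 0 0 + mat A 1 1 = 0 := by
  have hsq : proj (A * A) = proj 1 := by
    rw [map_mul, map_one, ← pow_two]
    exact orderOf_dvd_iff_pow_eq_one.1 h.dvd
  have hne : proj A ≠ proj 1 := by
    rw [map_one]
    intro h1
    rw [h1, orderOf_one] at h
    norm_num at h
  have hdet := mat_det A
  have e : mat A = !![mat A 0 0, mat A 0 1; mat A 1 0, mat A 1 1] := Matrix.eta_fin_two _
  rw [proj_eq_iff, mat_mul, mat_one] at hsq
  rw [Ne, proj_eq_iff, mat_one] at hne
  by_contra htr
  have hoff : mat A 0 1 * (mat A 0 0 + mat A 1 1) = 0 ∧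
      mat A 1 0 * (mat A 0 0 + mat A 1 1) = 0 ∧
      mat A 0 0 * mat A 0 0 + mat A 0 1 * mat A 1 0 =
        mat A 1 0 * mat A 0 1 + mat A 1 1 * mat A 1 1 := by
    rw [e, Matrix.mul_fin_two] at hsq
    have key : ∀ x y z w : ZLam, (!![x, y; z, w] = 1 ∨ !![x, y; z, w] = -1) →
        y = 0 ∧ z = 0 ∧ x = w := by
      intro x y z w h
      rcases h with h | h <;>
        · have h01 := congrFun (congrFun h 0) 1
          have h10 := congrFun (congrFun h 1) 0
          have h00 := congrFun (congrFun h 0) 0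
          have h11 := congrFun (congrFun h 1) 1
          simp at h00 h01 h10 h11
          exact ⟨h01, h10, h00.trans h11.symm⟩
    obtain ⟨hy, hz, hx⟩ := key _ _ _ _ hsq
    exact ⟨by linear_combination hy, by linear_combination hz, hx⟩
  obtain ⟨hb, hc, hx⟩ := hoff
  replace hb := (mul_eq_zero.1 hb).resolve_right htr
  replace hc := (mul_eq_zero.1 hc).resolve_right htr
  have had : mat A 0 0 = mat A 1 1 := by
    have : (mat A 0 0 - mat A 1 1) * (mat A 0 0 + mat A 1 1) = 0 := by
      linear_combination hx
    exact sub_eq_zero.1 ((mul_eq_zero.1 this).resolve_right htr)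
  rw [hb, hc, had] at hdet e
  apply hne
  rcases mul_self_eq_one_iff.1
    (show mat A 1 1 * mat A 1 1 = 1 by linear_combination hdet) with h | h
  · left
    rw [e, h, Matrix.one_fin_two]
  · right
    rw [e, h]
    ext i j; fin_cases i <;> fin_cases j <;> simp

theorem orderOf_proj_hS : orderOf (proj hS) = 2 := by
  refine orderOf_eq_prime (by rw [pow_two, proj_hS_mul_self]) ?_
  rw [← map_one proj, Ne, proj_eq_iff, mat_hS, mat_one]
  rintro (h | h)
  · have := congrFun (congrFun h 0) 1
    simp at this
  · have := congrFun (congrFun h 0) 1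
    simp at this

theorem swap_apply_eq_self_iff (i : Fin 5) :
    Equiv.swap (0 : Fin 5) 4 i = i ↔ i ∈ ({1, 2, 3} : Set (Fin 5)) := by
  simp only [Set.mem_insert_iff, Set.mem_singleton_iff]
  revert i
  decide

/-- The elliptic points of order `2` of the pentagon subgroup are the `g i` for which `S` fixes the
coset of `g⁻¹`. -/
theorem mem_ellipticPointsTwo_iff (z : ℍ) : z ∈ ellipticPointsTwo pentagonSubgroup ↔
    ∃ g : H5, z = g • UpperHalfPlane.I ∧ permHom (proj g⁻¹) 0 ∈ ({1, 2, 3} : Set (Fin 5)) := by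
  have hmem : ∀ g : H5, proj (g * hS * g⁻¹) ∈ pentagonSubgroup ↔
      permHom (proj g⁻¹) 0 ∈ ({1, 2, 3} : Set (Fin 5)) := by
    intro g
    rw [mem_pentagonSubgroup_iff, ← swap_apply_eq_self_iff, ← permHom_hS]
    simp only [map_mul, Equiv.Perm.mul_apply]
    rw [← Equiv.Perm.eq_inv_iff_eq, ← map_inv, ← map_inv]
  constructor
  · rintro ⟨⟨h, hK⟩, hord, hz⟩
    obtain ⟨c, hc⟩ := isConj_iff.1
      (isConj_proj_hS_of_trace_eq_zero (trace_eq_zero_of_orderOf_eq_two hord))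
    obtain ⟨C, rfl⟩ := proj_surjective c
    rw [← map_inv, ← map_mul, ← map_mul] at hc
    refine ⟨C, ?_, (hmem C).1 (by rw [hc]; exact hK)⟩
    have hz' : (C * hS * C⁻¹) • z = z := (smul_eq_of_proj_eq hc z).trans hz
    rw [mul_smul, mul_smul, ← eq_inv_smul_iff, hS_smul_eq_self_iff, inv_smul_eq_iff] at hz'
    exact hz'
  · rintro ⟨g, rfl, hg⟩
    refine ⟨⟨g * hS * g⁻¹, (hmem g).2 hg⟩, ?_, ?_⟩
    · change orderOf (proj (g * hS * g⁻¹)) = 2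
      rw [map_mul, map_mul, map_inv, ← MulAut.conj_apply, MulEquiv.orderOf_eq]
      exact orderOf_proj_hS
    · change (g * hS * g⁻¹) • g • UpperHalfPlane.I = g • UpperHalfPlane.I
      rw [← mul_smul, inv_mul_cancel_right, mul_smul, (hS_smul_eq_self_iff _).2 rfl]

theorem permHom_inv_hU_pow (j : Fin 5) : permHom (proj (hU ^ (j : ℕ))⁻¹) 0 = j := by
  rw [map_inv, map_inv, map_pow, map_pow, permHom_hU]
  revert j
  decide

/-- The orbits of elliptic points of order `2` correspond to the fixed points of `S` on the
cosets. -/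
theorem pentagonSubgroup_v2 : v2 pentagonSubgroup = 3 := by
  let f (j : Fin 5) : Quotient (MulAction.orbitRel (preimageH pentagonSubgroup) ℍ) :=
    Quotient.mk _ (hU ^ (j : ℕ) • UpperHalfPlane.I)
  have himage : (fun z : ℍ =>
      (Quotient.mk (MulAction.orbitRel (preimageH pentagonSubgroup) ℍ) z)) ''
        ellipticPointsTwo pentagonSubgroup = f '' {1, 2, 3} := by
    ext q
    constructor
    · rintro ⟨z, hz, rfl⟩
      obtain ⟨g, rfl, hg⟩ := (mem_ellipticPointsTwo_iff z).1 hz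
      refine ⟨_, hg, ?_⟩
      set j := permHom (proj g⁻¹) 0 with hj
      refine Quotient.sound ?_
      have hk : (hU ^ (j : ℕ)) * g⁻¹ ∈ preimageH pentagonSubgroup := by
        change proj _ ∈ pentagonSubgroup
        rw [mem_pentagonSubgroup_iff, map_mul, map_mul, Equiv.Perm.mul_apply, ← hj,
          ← Equiv.Perm.eq_inv_iff_eq, ← map_inv, ← map_inv, permHom_inv_hU_pow]
      refine ⟨⟨_, hk⟩, ?_⟩
      change (hU ^ (j : ℕ) * g⁻¹) • g • UpperHalfPlane.I = _
      rw [← mul_smul, inv_mul_cancel_right]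
    · rintro ⟨j, hj, rfl⟩
      refine ⟨_, (mem_ellipticPointsTwo_iff _).2 ⟨_, rfl, ?_⟩, rfl⟩
      rwa [permHom_inv_hU_pow]
  have hinj : Set.InjOn f {1, 2, 3} := by
    intro j hj l hl hjl
    obtain ⟨⟨k, hk⟩, hk'⟩ := Quotient.exact hjl
    have hK : permHom (proj k) 0 = 0 := (mem_pentagonSubgroup_iff _).1 hk
    have hfix : (((hU ^ (j : ℕ))⁻¹ * k * hU ^ (l : ℕ)) • UpperHalfPlane.I : ℍ) =
        UpperHalfPlane.I := by
      rw [mul_smul, mul_smul, inv_smul_eq_iff]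
      exact hk'
    have hl0 : permHom (proj (hU ^ (l : ℕ))) l = 0 := by
      rw [← Equiv.Perm.eq_inv_iff_eq, ← map_inv, ← map_inv, permHom_inv_hU_pow]
    have hperm : permHom (proj ((hU ^ (j : ℕ))⁻¹ * k * hU ^ (l : ℕ))) l = j := by
      rw [map_mul, map_mul, map_mul, map_mul, Equiv.Perm.mul_apply, Equiv.Perm.mul_apply, hl0, hK,
        permHom_inv_hU_pow]
    rcases proj_eq_of_smul_I_eq_I hfix with h | h
    · rw [h, map_one] at hperm
      exact hperm.symm
    · rw [h, permHom_hS, (swap_apply_eq_self_iff l).2 hl] at hperm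
      exact hperm.symm
  rw [v2, himage, hinj.ncard_image]
  rw [Set.ncard_eq_toFinset_card']
  decide

/-! ### Principal congruence subgroups -/

/-- Reduction of `H₅` modulo `p`. -/
noncomputable abbrev reduction (p : ZLam) :
    H5 →* Matrix.SpecialLinearGroup (Fin 2) (ZLam ⧸ Ideal.span ({p} : Set ZLam)) :=
  (Matrix.SpecialLinearGroup.map (n := Fin 2)
    (Ideal.Quotient.mk (Ideal.span ({p} : Set ZLam)))).comp H5.subtype

instance principalH_normal (p : ZLam) : (principalH p).Normal :=
  inferInstanceAs (reduction p).ker.Normal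

theorem reduction_eq_iff (p : ZLam) (A B : H5) :
    reduction p A = reduction p B ↔ ∀ i j, p ∣ mat A i j - mat B i j := by
  rw [Matrix.SpecialLinearGroup.ext_iff]
  refine forall_congr' fun i => forall_congr' fun j => ?_
  rw [← Ideal.mem_span_singleton, ← Ideal.Quotient.eq]
  rfl

theorem mem_principalH_iff (p : ZLam) (A : H5) :
    A ∈ principalH p ↔ ∀ i j, p ∣ mat A i j - (1 : Matrix (Fin 2) (Fin 2) ZLam) i j := by
  rw [← mat_one, ← reduction_eq_iff, map_one]
  exact MonoidHom.mem_ker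

theorem principalH_le_of_dvd {p q : ZLam} (h : p ∣ q) : principalH q ≤ principalH p := by
  intro A hA
  rw [mem_principalH_iff] at hA ⊢
  exact fun i j => h.trans (hA i j)

theorem hT_zpow_mem_principalH {p : ZLam} {j : ℤ} (h : p ∣ (j : ZLam)) :
    hT ^ j ∈ principalH p := by
  rw [mem_principalH_iff, mat_hT_zpow]
  intro i j'
  fin_cases i <;> fin_cases j' <;> simp [h.mul_right]

theorem hU_pow_five : hU ^ 5 = hS ^ 2 := by
  apply mat_injective
  rw [mat_hU_pow.2.2.2.2.2, show mat (hS ^ 2) = -1 from congrArg Subtype.val hS_sq]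
  ext i j; fin_cases i <;> fin_cases j <;> simp

/-- `H₅` is the normal closure of `T`: modulo `T` one has `U = S`, so that `U ^ 5 = -I = S ^ 2`
gives `S ^ 3 = 1`, and `S ^ 4 = 1`. -/
theorem eq_top_of_hT_mem {R : Subgroup H5} [R.Normal] (hR : hT ∈ R) : R = ⊤ := by
  set q := QuotientGroup.mk' R with hq
  have hqT : q hT = 1 := by
    rw [← MonoidHom.mem_ker, hq, QuotientGroup.ker_mk']; exact hR
  have hqU : q hU = q hS := by rw [hU, map_mul, map_inv, hqT, inv_one, mul_one]
  have h2 : (hS ^ 2) ^ 2 = 1 := mat_injective (by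
    rw [pow_two, mat_mul, show mat (hS ^ 2) = -1 from congrArg Subtype.val hS_sq, mat_one,
      neg_mul_neg, one_mul])
  have h4 : q hS ^ 4 = 1 := by rw [← map_pow, show hS ^ 4 = (hS ^ 2) ^ 2 by group, h2, map_one]
  have h5 : q hS ^ 5 = q hS ^ 2 := by rw [← hqU, ← map_pow, hU_pow_five, hqU, map_pow]
  have hS1 : q hS = 1 := by
    have h3 : q hS ^ 3 = 1 := by
      have : q hS ^ 2 * q hS ^ 3 = q hS ^ 2 * 1 := by rw [← pow_add, mul_one, h5]
      exact mul_left_cancel this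
    rwa [pow_succ, h3, one_mul] at h4
  rw [eq_top_iff, ← closure_hS_hT, Subgroup.closure_le]
  rintro x (rfl | rfl)
  · rw [SetLike.mem_coe, ← QuotientGroup.ker_mk' R, MonoidHom.mem_ker]; exact hS1
  · exact hR

/-- Every nonzero element of `ℤ[λ]` divides its norm `x ^ 2 + x y - y ^ 2`. -/
theorem exists_nat_ne_zero_dvd {p : ZLam} (hp : p ≠ 0) : ∃ n : ℕ, n ≠ 0 ∧ p ∣ (n : ZLam) := by
  obtain ⟨x, y, rfl⟩ := exists_int_add_int_mul_lam p
  have hmul : ((x : ZLam) + y * lam) * (((x + y : ℤ) : ZLam) + ((-y : ℤ) : ZLam) * lam) =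
      ((x * x + x * y - y * y : ℤ) : ZLam) := by
    push_cast
    linear_combination -(y : ZLam) * y * lam_sq
  have hne : (x * x + x * y - y * y : ℤ) ≠ 0 := by
    intro h0
    rw [h0, Int.cast_zero] at hmul
    rcases mul_eq_zero.1 hmul with h | h
    · exact hp h
    · obtain ⟨h1, h2⟩ := int_add_int_mul_lam_eq_zero h
      apply hp
      rw [show y = 0 by omega, show x = 0 by omega]
      simp
  refine ⟨(x * x + x * y - y * y).natAbs, Int.natAbs_ne_zero.2 hne, ?_⟩
  have h : (x : ZLam) + y * lam ∣ ((x * x + x * y - y * y : ℤ) : ZLam) := ⟨_, hmul.symm⟩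
  rw [Nat.cast_natAbs]
  rcases abs_choice (x * x + x * y - y * y) with h' | h' <;> rw [h']
  · exact h
  · rw [Int.cast_neg]; exact (dvd_neg).2 h

/-- The odd part of the level can be dropped: if `N` is normal, contains `T ^ 4` and `H(2 ^ k m)`
with `m` odd, then it contains `H(2 ^ k)`. -/
theorem principalH_two_pow_le {N : Subgroup H5} [N.Normal] (hT4 : hT ^ 4 ∈ N) {k m : ℕ}
    (hm : Odd m) (h : principalH ((2 ^ k * m : ℕ) : ZLam) ≤ N) :
    principalH ((2 ^ k : ℕ) : ZLam) ≤ N := by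
  have hcop : Nat.Coprime (4 * 2 ^ k) m := by
    rw [show 4 * 2 ^ k = 2 ^ (k + 2) by ring]
    exact (Nat.coprime_two_left.2 hm).pow_left _
  -- The power `T ^ j` lies in `N` and in `H(2 ^ k)`, but it is congruent to `T` modulo `m`.
  obtain ⟨j, hj0, hj1⟩ := Nat.chineseRemainder hcop 0 1
  obtain ⟨i, rfl⟩ := (Nat.modEq_zero_iff_dvd).1 hj0
  set j := 4 * 2 ^ k * i with hj
  let M : Subgroup H5 := Subgroup.normalClosure {hT ^ j}
  have hMN : M ≤ N := Subgroup.normalClosure_le_normal (by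
    rw [Set.singleton_subset_iff, hj, mul_assoc, pow_mul]
    exact pow_mem hT4 _)
  have hMk : M ≤ principalH ((2 ^ k : ℕ) : ZLam) := Subgroup.normalClosure_le_normal (by
    rw [Set.singleton_subset_iff, SetLike.mem_coe, ← zpow_natCast]
    refine hT_zpow_mem_principalH ?_
    rw [Int.cast_natCast]
    exact Nat.cast_dvd_cast ⟨4 * i, by rw [hj]; ring⟩)
  have hsup : M ⊔ principalH (m : ZLam) = ⊤ := by
    refine eq_top_of_hT_mem ?_
    have e : hT = hT ^ j * hT ^ (1 - j : ℤ) := by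
      rw [← zpow_natCast, ← zpow_add, add_sub_cancel, zpow_one]
    rw [e]
    refine Subgroup.mul_mem_sup (Subgroup.subset_normalClosure rfl) (hT_zpow_mem_principalH ?_)
    obtain ⟨c, hc⟩ := (Nat.modEq_iff_dvd).1 hj1
    refine ⟨(c : ZLam), ?_⟩
    rw [Nat.cast_one] at hc
    rw [hc]
    push_cast
    ring
  intro g hg
  have hg' : g ∈ M ⊔ principalH (m : ZLam) := by rw [hsup]; trivial
  obtain ⟨μ, hμ, x, hx, rfl⟩ := Subgroup.mem_sup_of_normal_left.1 hg'
  have hx2 : x ∈ principalH ((2 ^ k : ℕ) : ZLam) := (Subgroup.mul_mem_cancel_left _ (hMk hμ)).1 hg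
  refine mul_mem (hMN hμ) (h ?_)
  rw [mem_principalH_iff] at hx hx2 ⊢
  intro i j
  rw [Nat.cast_mul]
  refine IsCoprime.mul_dvd ?_ (hx2 i j) (hx i j)
  have := (Nat.isCoprime_iff_coprime.2 ((Nat.coprime_two_left.2 hm).pow_left k)).map
    (Int.castRingHom ZLam)
  simpa using this

/-! ### Solvability of the quotients by powers of two -/

/-- In a group generated by `s`, `u` in which `s` and `u⁻¹ s` are involutions, as in a dihedral
group, all commutators are powers of `u`. -/
theorem commutatorElement_mem_zpowers {G : Type*} [Group G] {s u : G} (hs : s * s = 1)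
    (ht : (u⁻¹ * s) * (u⁻¹ * s) = 1) (hgen : Subgroup.closure {s, u} = ⊤) (g h : G) :
    ⁅g, h⁆ ∈ Subgroup.zpowers u := by
  have hsinv : s⁻¹ = s := inv_eq_of_mul_eq_one_right hs
  have hsus : s * u * s⁻¹ = u⁻¹ := by
    have := inv_eq_of_mul_eq_one_right ht
    rw [mul_inv_rev, inv_inv] at this
    rw [hsinv] at this ⊢
    rw [this, mul_assoc, hs, mul_one]
  have hconj : ∀ j : ℤ, s * u ^ j = u ^ (-j) * s := fun j => by
    rw [← mul_inv_eq_iff_eq_mul, ← conj_zpow, hsus, inv_zpow']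
  have hform : ∀ g : G, ∃ i : ℤ, g = u ^ i ∨ g = u ^ i * s := by
    intro g
    have hg : g ∈ Subgroup.closure {s, u} := by rw [hgen]; trivial
    have step : ∀ e : ℤ, ∀ x : G, (∃ i : ℤ, x = u ^ i ∨ x = u ^ i * s) →
        ∃ i : ℤ, x * u ^ e = u ^ i ∨ x * u ^ e = u ^ i * s := by
      rintro e x ⟨i, rfl | rfl⟩
      · exact ⟨i + e, Or.inl (zpow_add _ _ _).symm⟩
      · exact ⟨i - e, Or.inr (by rw [mul_assoc, hconj, ← mul_assoc, ← zpow_add, sub_eq_add_neg])⟩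
    have step' : ∀ x : G, (∃ i : ℤ, x = u ^ i ∨ x = u ^ i * s) →
        ∃ i : ℤ, x * s = u ^ i ∨ x * s = u ^ i * s := by
      rintro x ⟨i, rfl | rfl⟩
      · exact ⟨i, Or.inr rfl⟩
      · exact ⟨i, Or.inl (by rw [mul_assoc, hs, mul_one])⟩
    induction hg using Subgroup.closure_induction_right with
    | one => exact ⟨0, by simp⟩
    | mul_right x hx y hy ih =>
      rcases hy with rfl | rfl
      · exact step' x ih
      · simpa using step 1 x ih
    | mul_inv_cancel x hx y hy ih =>
      rcases hy with rfl | rfl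
      · rw [hsinv]; exact step' x ih
      · simpa using step (-1) x ih
  have hnormal : (Subgroup.zpowers u).Normal := by
    refine ⟨fun n hn g => ?_⟩
    obtain ⟨n, rfl⟩ := Subgroup.mem_zpowers_iff.1 hn
    rw [Subgroup.mem_zpowers_iff]
    obtain ⟨i, rfl | rfl⟩ := hform g
    · exact ⟨n, by group⟩
    · refine ⟨-n, ?_⟩
      rw [show u ^ i * s * u ^ n * (u ^ i * s)⁻¹ = u ^ i * (s * u ^ n * s⁻¹) * (u ^ i)⁻¹ by group,
        hconj, mul_inv_cancel_right]
      group
  -- The quotient by `⟨u⟩` has only the elements `1` and `s`.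
  have hq : ∀ g : G, QuotientGroup.mk' (Subgroup.zpowers u) g = 1 ∨
      QuotientGroup.mk' (Subgroup.zpowers u) g = QuotientGroup.mk' (Subgroup.zpowers u) s := by
    intro g
    have hu : QuotientGroup.mk' (Subgroup.zpowers u) u = 1 := by
      rw [← MonoidHom.mem_ker, QuotientGroup.ker_mk']; exact Subgroup.mem_zpowers u
    obtain ⟨i, rfl | rfl⟩ := hform g
    · left; rw [map_zpow, hu, one_zpow]
    · right; rw [map_mul, map_zpow, hu, one_zpow, one_mul]
  rw [← QuotientGroup.ker_mk' (Subgroup.zpowers u), MonoidHom.mem_ker, map_commutatorElement,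
    commutatorElement_eq_one_iff_mul_comm]
  rcases hq g with h1 | h1 <;> rcases hq h with h2 | h2 <;> simp only [h1, h2, one_mul, mul_one]

/-- Modulo `q ^ 2` the elements of `H(q)` commute, because
`A B - B A = (A - 1) (B - 1) - (B - 1) (A - 1)`. -/
theorem commutator_principalH_le (q : ZLam) (h : 2 ∣ q) :
    ⁅principalH q, principalH q⁆ ≤ principalH (q * 2) := by
  rw [Subgroup.commutator_le]
  intro A hA B hB
  rw [mem_principalH_iff] at hA hB
  have hcomm : reduction (q * 2) (A * B) = reduction (q * 2) (B * A) := by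
    rw [reduction_eq_iff]
    have key : ∀ i j, mat (A * B) i j - mat (B * A) i j =
        ((mat A - 1) * (mat B - 1) - (mat B - 1) * (mat A - 1)) i j := by
      intro i j
      rw [mat_mul, mat_mul, ← Matrix.sub_apply]
      refine congrFun (congrFun ?_ i) j
      noncomm_ring
    intro i j
    refine (mul_dvd_mul_left q h).trans ?_
    rw [key, Matrix.sub_apply, Matrix.mul_apply, Matrix.mul_apply]
    exact dvd_sub (Finset.dvd_sum fun l _ => mul_dvd_mul (hA i l) (hB l j))
      (Finset.dvd_sum fun l _ => mul_dvd_mul (hB i l) (hA l j))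
  change ⁅A, B⁆ ∈ (reduction (q * 2)).ker
  rw [MonoidHom.mem_ker, map_commutatorElement, commutatorElement_eq_one_iff_mul_comm, ← map_mul,
    ← map_mul, hcomm]

/-- The image of `H₅` modulo `2` is dihedral, because `T ^ 2` is trivial modulo `2`. -/
theorem derivedSeries_two_le : derivedSeries H5 2 ≤ principalH 2 := by
  set f := (reduction 2).rangeRestrict with hf
  have hmem : ∀ A : H5, f A = 1 ↔ A ∈ principalH 2 := fun A => by
    rw [← MonoidHom.mem_ker, hf, MonoidHom.ker_rangeRestrict]; rfl
  have hs : f hS * f hS = 1 := by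
    rw [← map_mul, ← pow_two, hmem, mem_principalH_iff,
      show mat (hS ^ 2) = -1 from congrArg Subtype.val hS_sq]
    intro i j
    exact ⟨-(1 : Matrix (Fin 2) (Fin 2) ZLam) i j, by rw [Matrix.neg_apply]; ring⟩
  have ht : ((f hU)⁻¹ * f hS) * ((f hU)⁻¹ * f hS) = 1 := by
    rw [← map_inv, ← map_mul, ← hT_eq, ← map_mul, ← zpow_two, hmem]
    exact hT_zpow_mem_principalH (by norm_num)
  have hgen : Subgroup.closure {f hS, f hU} = ⊤ := by
    rw [← Set.image_pair, ← MonoidHom.map_closure, closure_hS_hU,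
      Subgroup.map_top_of_surjective _ (MonoidHom.rangeRestrict_surjective _)]
  have h1 : derivedSeries H5 1 ≤ (Subgroup.zpowers (f hU)).comap f := by
    rw [derivedSeries_one, commutator_def, Subgroup.commutator_le]
    intro A _ B _
    rw [Subgroup.mem_comap, map_commutatorElement]
    exact commutatorElement_mem_zpowers hs ht hgen _ _
  rw [derivedSeries_succ]
  refine (Subgroup.commutator_mono h1 h1).trans ?_
  rw [Subgroup.commutator_le]
  intro A hA B hB
  obtain ⟨a, ha⟩ := Subgroup.mem_zpowers_iff.1 (Subgroup.mem_comap.1 hA)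
  obtain ⟨b, hb⟩ := Subgroup.mem_zpowers_iff.1 (Subgroup.mem_comap.1 hB)
  rw [← hmem, map_commutatorElement, commutatorElement_eq_one_iff_mul_comm, ← ha, ← hb,
    ← zpow_add, ← zpow_add, add_comm]

theorem derivedSeries_le_principalH (k : ℕ) :
    derivedSeries H5 (k + 2) ≤ principalH ((2 ^ (k + 1) : ℕ) : ZLam) := by
  induction k with
  | zero => simpa using derivedSeries_two_le
  | succ k ih =>
    rw [show k + 1 + 2 = (k + 2) + 1 by ring, derivedSeries_succ]
    refine (Subgroup.commutator_mono ih ih).trans ?_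
    have := commutator_principalH_le ((2 ^ (k + 1) : ℕ) : ZLam)
      (by push_cast; exact dvd_pow_self _ (by omega))
    convert this using 2
    push_cast
    ring

/-- If the pentagon subgroup were congruence, then the symmetric group on five letters would be a
quotient of `H₅ / H(2 ^ k)` for some `k`, which is solvable. -/
theorem pentagonSubgroup_not_isCongruence : ¬ IsCongruence pentagonSubgroup := by
  rintro ⟨p, hp, hle⟩
  set f : H5 →* Equiv.Perm (Fin 5) := permHom.comp proj with hf
  have hfsurj : Function.Surjective f := permHom_surjective.comp proj_surjective
  have hpker : principalH p ≤ f.ker := by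
    intro A hA
    rw [MonoidHom.mem_ker]
    ext1 i
    obtain ⟨g, hg⟩ := hfsurj (Equiv.swap 0 i)
    have hA' : g⁻¹ * A * g⁻¹⁻¹ ∈ principalH p := (principalH_normal p).conj_mem A hA g⁻¹
    have h0 : f (g⁻¹ * A * g⁻¹⁻¹) 0 = 0 :=
      (mem_pentagonSubgroup_iff _).1 (hle (Subgroup.mem_map_of_mem _ hA'))
    rw [inv_inv, map_mul, map_mul, map_inv, Equiv.Perm.mul_apply, Equiv.Perm.mul_apply,
      Equiv.Perm.inv_eq_iff_eq, hg, Equiv.swap_apply_left] at h0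
    exact h0
  obtain ⟨n, hn, hpn⟩ := exists_nat_ne_zero_dvd hp
  obtain ⟨k, m, hm, rfl⟩ := Nat.exists_eq_two_pow_mul_odd hn
  have hT4 : hT ^ 4 ∈ f.ker := by
    rw [MonoidHom.mem_ker, map_pow, hf, MonoidHom.comp_apply, permHom_hT]
    decide
  have hk : principalH ((2 ^ k : ℕ) : ZLam) ≤ f.ker :=
    principalH_two_pow_le hT4 hm ((principalH_le_of_dvd hpn).trans hpker)
  have hder : derivedSeries H5 (k + 2) ≤ f.ker :=
    (derivedSeries_le_principalH k).trans
      ((principalH_le_of_dvd (Nat.cast_dvd_cast (pow_dvd_pow 2 k.le_succ))).trans hk)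
  refine Equiv.Perm.not_isSolvable_fin_5 ⟨k + 2, ?_⟩
  rw [← map_derivedSeries_eq hfsurj, Subgroup.map_eq_bot_iff]
  exact hder

end HeckeFive

theorem mainTheorem7 :
    (HeckeFive.pentagonSubgroup.index = 5 ∧
      HeckeFive.v2 HeckeFive.pentagonSubgroup = 3 ∧
      HeckeFive.geometricLevel HeckeFive.pentagonSubgroup = 4 ∧
      {L : Subgroup HeckeFive.G5 | ∃ g : HeckeFive.G5,
        L = HeckeFive.pentagonSubgroup.map (MulAut.conj g).toMonoidHom}.ncard = 5 ∧
      ¬ HeckeFive.IsCongruence HeckeFive.pentagonSubgroup) ∧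
    (¬ ∀ K : Subgroup HeckeFive.G5,
      K.index ≠ 0 → K.index ≤ 6 → HeckeFive.IsCongruence K) ∧
    (∀ K : Subgroup (Matrix.ProjectiveSpecialLinearGroup (Fin 2) ℤ),
      K.index ≠ 0 → K.index ≤ 6 → HeckeFive.IsCongruencePSL K) := by
  refine ⟨⟨HeckeFive.pentagonSubgroup_index, HeckeFive.pentagonSubgroup_v2,
    HeckeFive.pentagonSubgroup_geometricLevel, HeckeFive.pentagonSubgroup_conjugates_ncard,
    HeckeFive.pentagonSubgroup_not_isCongruence⟩, fun h => ?_,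
    HeckeFive.isCongruencePSL_of_index_le_six⟩
  have hidx := HeckeFive.pentagonSubgroup_index
  exact HeckeFive.pentagonSubgroup_not_isCongruence
    (h _ (by rw [hidx]; norm_num) (by rw [hidx]; norm_num))
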